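/- Let $(X,d,\mu)$ be a complete metric measure space with a doubling Borel measure: there is $C_D\ge 1$ with $0<\mu(B_{2r}(x))\le C_D\,\mu(B_r(x))<\infty$ for all $x\in X$, $r>0$. Let $\Omega\subset X$ be open, let $1<p\le q$, and let $a:X\to[0,\infty)$ be measurable on $\Omega$. Put $H(x,z)=|z|^p+a(x)|z|^q$. Write $A\Subset\Omega$ if $\overline A$ is a compact subset of $\Omega$. For open $U\subset X$, $N^{1,1}(U)$ is the space of functions $u\in L^1(U)$ with values in $[-\infty,\infty]$ having an upper gradient in $L^1(U)$ (that is, a Borel function $g\ge 0$ with $|u(x)-u(y)|\le\int_\gamma g\,ds$ for every nonconstant rectifiable curve $\gamma$ in $U$ with endpoints $x,y$, the right-hand side being $\infty$ when $u(x)$ or $u(y)$ is infinite). $N^{1,1}_{\rm loc}(\Omega)$ consists of the functions in $N^{1,1}(\Omega')$ for all open $\Omega'\Subset\Omega$; likewise for $L^1_{\rm loc}(\Omega)$. $N^{1,1}_0(\Omega')$ is the set of functions in $N^{1,1}(X)$ vanishing $\mu$-a.e. on $X\setminus\Omega'$, and a function given on $\Omega'$ is said to belong to it if it agrees a.e. on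 $\Omega'$ with such a function. Moreover $g_u$ is the minimal $1$-weak upper gradient of $u$: the a.e. smallest among the locally integrable functions satisfying the upper gradient inequality for all curves outside a family of zero $1$-modulus. Let $K\ge1$. A function $u\in N^{1,1}_{\rm loc}(\Omega)$ with $H(\cdot,g_u)\in L^1_{\rm loc}(\Omega)$ is a local quasiminimizer on $\Omega$ with constant $K$ if $$\int_{\Omega'\cap\{u\neq v\}}H(x,g_u)\,d\mu\le K\int_{\Omega'\cap\{u\ne v\}}H(x,g_v)\,d\mu$$ for all open $\Omega'\Subset\Omega$ and all $v\in N^{1,1}(\Omega')$ with $u-v\in N^{1,1}_0(\Omega')$. Then there is a constant $C=C(K,q)>0$, depending only on $K$ and $q$, such that every local quasiminimizer $u$ on $\Omega$ with constant $K$ satisfies, for all concentric balls $B_\rho\subset B_R\Subset\Omega$ with $0<\rho<R$, all $k\in\mathbb R$ and both signs, $$\int_{B_\rho}H\bigl(x,g_{(u-k)_\pm}\bigr)\,d\mu\le C\int_{B_R}H\Bigl(x,\frac{(u-k)_\pm}{R-\rho}\Bigr)\,d\mu,$$ where $(u-k)_+=\max\{u-k,0\}$, $(u-k)_-=\max\{-(u-k),0\}$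 and the right-hand side may be $\infty$. Consequently $u$ belongs to the double phase De Giorgi class $DG_H(\Omega)=DG_H^+(\Omega)\cap DG_H^-(\Omega)$, where $DG_H^\pm(\Omega)$ consists of the $u\in N^{1,1}_{\rm loc}(\Omega)$ with $H(\cdot,g_u)\in L^1_{\rm loc}(\Omega)$ that satisfy this inequality, with the corresponding sign and some constant $C>0$, for all such balls and all $k\in\mathbb R$. -/

import Mathlib

open MeasureTheory Set
open scoped ENNReal NNReal

noncomputable section

namespace DoublePhase

/-- A nonconstant (compact) rectifiable curve in `X`, parametrized by arc length on `[0, len]`.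
Only the values of `toFun` on `[0, len]` are used. -/
structure Curve (X : Type*) [MetricSpace X] where
  len : ℝ
  len_pos : 0 < len
  toFun : ℝ → X
  unitSpeed : HasUnitSpeedOn toFun (Icc 0 len)

/-- The curve stays in `U`. -/
def Curve.LiesIn {X : Type*} [MetricSpace X] (γ : Curve X) (U : Set X) : Prop :=
  ∀ t ∈ Icc (0 : ℝ) γ.len, γ.toFun t ∈ U

/-- The path integral `∫_γ g ds`. -/
def Curve.integral {X : Type*} [MetricSpace X] (γ : Curve X) (g : X → ℝ≥0∞) : ℝ≥0∞ :=
  ∫⁻ t in Icc (0 : ℝ) γ.len, g (γ.toFun t)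

/-- The upper gradient inequality for `u` along one curve `γ`:
`|u(x) - u(y)| ≤ ∫_γ g ds` if `u` is finite at both endpoints `x`, `y` of `γ`, and
`∫_γ g ds = ∞` otherwise. -/
def UpperGradientIneq {X : Type*} [MetricSpace X]
    (u : X → EReal) (g : X → ℝ≥0∞) (γ : Curve X) : Prop :=
  (∀ s t : ℝ, u (γ.toFun 0) = s → u (γ.toFun γ.len) = t →
      ENNReal.ofReal |s - t| ≤ γ.integral g) ∧
  ((¬ (∃ s : ℝ, u (γ.toFun 0) = s) ∨ ¬ (∃ t : ℝ, u (γ.toFun γ.len) = t)) →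
      γ.integral g = ∞)

/-- `g` is an upper gradient of `u` in `U`. -/
def IsUpperGradient {X : Type*} [MetricSpace X] [MeasurableSpace X]
    (U : Set X) (u : X → EReal) (g : X → ℝ≥0∞) : Prop :=
  Measurable g ∧ ∀ γ : Curve X, γ.LiesIn U → UpperGradientIneq u g γ

/-- The `1`-modulus of a family of curves. -/
def modulus {X : Type*} [MetricSpace X] [MeasurableSpace X]
    (μ : Measure X) (Γ : Set (Curve X)) : ℝ≥0∞ :=
  ⨅ (r : X → ℝ≥0∞) (_ : Measurable r) (_ : ∀ γ ∈ Γ, 1 ≤ γ.integral r), ∫⁻ x, r x ∂μ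

/-- `g` is a `1`-weak upper gradient of `u` in `U`: the inequality holds for all curves in `U`
outside a family of zero `1`-modulus. -/
def IsWeakUpperGradient {X : Type*} [MetricSpace X] [MeasurableSpace X]
    (μ : Measure X) (U : Set X) (u : X → EReal) (g : X → ℝ≥0∞) : Prop :=
  Measurable g ∧ modulus μ {γ : Curve X | γ.LiesIn U ∧ ¬ UpperGradientIneq u g γ} = 0

/-- `A ⋐ U`. -/
def CompactlyIn {X : Type*} [MetricSpace X] (A U : Set X) : Prop :=
  IsCompact (closure A) ∧ closure A ⊆ U

/-- The nonnegative function `f` is integrable on every open `V ⋐ U`. -/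
def LocallyFiniteIntegral {X : Type*} [MetricSpace X] [MeasurableSpace X]
    (μ : Measure X) (U : Set X) (f : X → ℝ≥0∞) : Prop :=
  ∀ V : Set X, IsOpen V → CompactlyIn V U → ∫⁻ x in V, f x ∂μ < ∞

/-- `u ∈ N^{1,1}(U)` (for a representative `u`, of which only the values on `U` are used):
`u` is in `L¹(U)` and has an upper gradient in `L¹(U)`. -/
def MemNewtonian {X : Type*} [MetricSpace X] [MeasurableSpace X]
    (μ : Measure X) (U : Set X) (u : X → EReal) : Prop :=
  AEMeasurable u (μ.restrict U) ∧ ∫⁻ x in U, (u x).abs ∂μ < ∞ ∧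
    ∃ g : X → ℝ≥0∞, IsUpperGradient U u g ∧ ∫⁻ x in U, g x ∂μ < ∞

/-- `u ∈ N^{1,1}_loc(U)`. -/
def MemNewtonianLoc {X : Type*} [MetricSpace X] [MeasurableSpace X]
    (μ : Measure X) (U : Set X) (u : X → EReal) : Prop :=
  ∀ V : Set X, IsOpen V → CompactlyIn V U → MemNewtonian μ V u

/-- `f ∈ N^{1,1}_0(U)` for a function `f` given on `U`: it is the restriction of a function of
`N^{1,1}(X)` that vanishes almost everywhere on `X \ U`. -/
def MemNewtonianZero {X : Type*} [MetricSpace X] [MeasurableSpace X]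
    (μ : Measure X) (U : Set X) (f : X → EReal) : Prop :=
  ∃ w : X → EReal, MemNewtonian μ univ w ∧
    (∀ᵐ x ∂μ.restrict U, w x = f x) ∧ (∀ᵐ x ∂μ.restrict Uᶜ, w x = 0)

/-- `g` is a minimal `1`-weak upper gradient of `u` in `U`. -/
def IsMinimalWeakUpperGradient {X : Type*} [MetricSpace X] [MeasurableSpace X]
    (μ : Measure X) (U : Set X) (u : X → EReal) (g : X → ℝ≥0∞) : Prop :=
  IsWeakUpperGradient μ U u g ∧ LocallyFiniteIntegral μ U g ∧
    ∀ g' : X → ℝ≥0∞, IsWeakUpperGradient μ U u g' → LocallyFiniteIntegral μ U g' →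
      ∀ᵐ x ∂μ.restrict U, g x ≤ g' x

open Classical in
/-- The minimal `1`-weak upper gradient `g_u` of `u` in `U`, unique up to null subsets of `U`
(it is `∞` by convention if there is none). -/
def minGrad {X : Type*} [MetricSpace X] [MeasurableSpace X]
    (μ : Measure X) (U : Set X) (u : X → EReal) : X → ℝ≥0∞ :=
  if h : ∃ g, IsMinimalWeakUpperGradient μ U u g then h.choose else fun _ => ∞

/-- The double phase density `H(x, z) = z^p + a(x) z^q`, `z ∈ [0, ∞]`. -/
def H {X : Type*} (a : X → ℝ≥0) (p q : ℝ) (x : X) (z : ℝ≥0∞) : ℝ≥0∞ :=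
  z ^ p + (a x : ℝ≥0∞) * z ^ q

/-- The doubling condition `0 < μ(B_{2r}) ≤ C_D μ(B_r) < ∞` for all balls. -/
def IsDoubling {X : Type*} [MetricSpace X] [MeasurableSpace X] (μ : Measure X) : Prop :=
  ∃ CD : ℝ, 1 ≤ CD ∧ ∀ (x : X) (r : ℝ), 0 < r →
    0 < μ (Metric.ball x (2 * r)) ∧
    μ (Metric.ball x (2 * r)) ≤ ENNReal.ofReal CD * μ (Metric.ball x r) ∧
    ENNReal.ofReal CD * μ (Metric.ball x r) < ∞

/-- `u ∈ N^{1,1}_loc(Ω)` and `H(·, g_u) ∈ L¹_loc(Ω)`. -/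
def HasLocallyFiniteEnergy {X : Type*} [MetricSpace X] [MeasurableSpace X]
    (μ : Measure X) (Ω : Set X) (a : X → ℝ≥0) (p q : ℝ) (u : X → EReal) : Prop :=
  MemNewtonianLoc μ Ω u ∧ LocallyFiniteIntegral μ Ω (fun x => H a p q x (minGrad μ Ω u x))

/-- `u` is a local quasiminimizer on `Ω` of the double phase integral, with constant `K`. -/
def IsLocalQuasiminimizer {X : Type*} [MetricSpace X] [MeasurableSpace X]
    (μ : Measure X) (Ω : Set X) (a : X → ℝ≥0) (p q K : ℝ) (u : X → EReal) : Prop :=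
  HasLocallyFiniteEnergy μ Ω a p q u ∧
  ∀ V : Set X, IsOpen V → CompactlyIn V Ω → ∀ v : X → EReal, MemNewtonian μ V v →
    MemNewtonianZero μ V (fun x => u x - v x) →
      ∫⁻ x in V ∩ {x | u x ≠ v x}, H a p q x (minGrad μ Ω u x) ∂μ ≤
        ENNReal.ofReal K * ∫⁻ x in V ∩ {x | u x ≠ v x}, H a p q x (minGrad μ V v x) ∂μ

/-- `(u - k)_+ = max {u - k, 0}`. -/
def truncPos {X : Type*} (u : X → EReal) (k : ℝ) (x : X) : EReal := max (u x - (k : EReal)) 0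

/-- `(u - k)_- = max {-(u - k), 0}`. -/
def truncNeg {X : Type*} (u : X → EReal) (k : ℝ) (x : X) : EReal := max (-(u x - (k : EReal))) 0

/-- The Caccioppoli inequality with constant `C`, for the truncations `T k` (`k ∈ ℝ`), on all
concentric balls `B_ρ ⊂ B_R ⋐ Ω`:
`∫_{B_ρ} H(x, g_{T k}) dμ ≤ C ∫_{B_R} H(x, T k / (R - ρ)) dμ`. -/
def Caccioppoli {X : Type*} [MetricSpace X] [MeasurableSpace X]
    (μ : Measure X) (Ω : Set X) (a : X → ℝ≥0) (p q C : ℝ) (T : ℝ → X → EReal) : Prop :=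
  ∀ (x₀ : X) (ρ R k : ℝ), 0 < ρ → ρ < R → CompactlyIn (Metric.ball x₀ R) Ω →
    ∫⁻ x in Metric.ball x₀ ρ, H a p q x (minGrad μ Ω (T k) x) ∂μ ≤
      ENNReal.ofReal C *
        ∫⁻ x in Metric.ball x₀ R, H a p q x ((T k x).toENNReal / ENNReal.ofReal (R - ρ)) ∂μ

/-- The class `DG_H^+(Ω)`. -/
def MemDGPos {X : Type*} [MetricSpace X] [MeasurableSpace X]
    (μ : Measure X) (Ω : Set X) (a : X → ℝ≥0) (p q : ℝ) (u : X → EReal) : Prop :=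
  HasLocallyFiniteEnergy μ Ω a p q u ∧ ∃ C : ℝ, 0 < C ∧ Caccioppoli μ Ω a p q C (truncPos u)

/-- The class `DG_H^-(Ω)`. -/
def MemDGNeg {X : Type*} [MetricSpace X] [MeasurableSpace X]
    (μ : Measure X) (Ω : Set X) (a : X → ℝ≥0) (p q : ℝ) (u : X → EReal) : Prop :=
  HasLocallyFiniteEnergy μ Ω a p q u ∧ ∃ C : ℝ, 0 < C ∧ Caccioppoli μ Ω a p q C (truncNeg u)

/-- The double phase De Giorgi class `DG_H(Ω) = DG_H^+(Ω) ∩ DG_H^-(Ω)`. -/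
def MemDG {X : Type*} [MetricSpace X] [MeasurableSpace X]
    (μ : Measure X) (Ω : Set X) (a : X → ℝ≥0) (p q : ℝ) (u : X → EReal) : Prop :=
  MemDGPos μ Ω a p q u ∧ MemDGNeg μ Ω a p q u

end DoublePhase

end

/-!
The inequality is the Caccioppoli estimate of De Giorgi's method, obtained by testing
quasiminimality with `v = u - η (u - k)_+`, where `η` is a Lipschitz cut-off function equal to
`1` on `B_s` and vanishing outside `B_t`, for `ρ ≤ s < t < R`. On `{u > k}` the Leibniz rule
gives `g_v ≤ (1 - η) g_u + (u - k)_+ / (t - s)`, and `1 - η` vanishes on `B_s`. Since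
`H(x, y + z) ≤ 2 ^ q (H(x, y) + H(x, z))`, the energy of `u` on `B_s ∩ {u > k}` is bounded by
`K 2 ^ q` times the sum of its energy on `(B_t \ B_s) ∩ {u > k}` and of the energy of
`(u - k)_+ / (t - s)` on `B_R` (`IsLocalQuasiminimizer.energy_le`). Filling the hole and
iterating over a geometric sequence of radii removes the first of these terms
(`exists_const_forall_le_of_hole_filling`); this uses that the energy of `u` on `B_R` is finite,
and yields a constant depending on `K` and `q` only. Finally `g_{(u - k)_+}` is at most `g_u` on
`{u > k}` and vanishes elsewhere (`minGrad_truncPos_le`). The estimate for `(u - k)_-` is the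
one for `-u`, which is a quasiminimizer too.

These calculus rules for minimal weak upper gradients rest on one principle: if `u` has a
locally integrable weak upper gradient `g`, then along `1`-almost every curve `γ` the function
`u ∘ γ` is finite, absolutely continuous and satisfies `|(u ∘ γ)'| ≤ g ∘ γ` almost everywhere
(`IsWeakUpperGradient.eventually_regularAlong`, `IsWeakUpperGradient.eventually_deriv_le`), and
conversely such a derivative bound makes `g` a weak upper gradient
(`isWeakUpperGradient_of_regularAlong`). "Almost every curve" is expressed by a filter
`curveAE μ` with the countable intersection property. The principle turns the Leibniz rule and
the truncation rule into one-variable calculus, and it shows that countable infima of weak upper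
gradients, even of weak upper gradients in different open sets, are weak upper gradients
(`isWeakUpperGradient_iInf`). The latter gives the existence of minimal weak upper gradients, in
particular for functions of `N^{1,1}_loc`. The space is exhausted by relatively compact open
sets, which is possible because a complete space with a doubling measure is proper
(`IsDoubling.properSpace`).
-/

noncomputable section

namespace DoublePhase

open Filter Topology

section

variable {X : Type*} [MetricSpace X]

/-! ### Curves and sub-curves -/

/-- The portion of the curve `γ` between the parameters `s` and `t`. -/
def Curve.sub (γ : Curve X) (s t : ℝ) (hs : 0 ≤ s) (hst : s < t) (ht : t ≤ γ.len) : Curve X where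
  len := t - s
  len_pos := sub_pos.2 hst
  toFun := fun r => γ.toFun (s + r)
  unitSpeed := by
    have h := γ.unitSpeed
    intro x hx y hy
    have hx' : s + x ∈ Icc 0 γ.len := ⟨by linarith [hx.1], by linarith [hx.2]⟩
    have hy' : s + y ∈ Icc 0 γ.len := ⟨by linarith [hy.1], by linarith [hy.2]⟩
    have := h hx' hy'
    rw [show s + y - (s + x) = y - x by ring] at this
    rw [← this]
    have hset : Icc 0 γ.len ∩ Icc (s + x) (s + y) =
        (fun r => s + r) '' (Icc 0 (t - s) ∩ Icc x y) := by
      ext z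
      simp only [mem_inter_iff, mem_Icc, mem_image] at hx hy hx' hy' ⊢
      constructor
      · rintro ⟨⟨_, _⟩, h3, h4⟩
        exact ⟨z - s, ⟨⟨by linarith, by linarith⟩, by linarith, by linarith⟩, by ring⟩
      · rintro ⟨r, ⟨⟨h1, h2⟩, h3, h4⟩, rfl⟩
        exact ⟨⟨by linarith, by linarith⟩, by linarith, by linarith⟩
    rw [hset]
    exact eVariationOn.comp_eq_of_monotoneOn γ.toFun (fun r => s + r)
      (fun a _ b _ hab => by simpa using hab)

lemma Curve.lipschitzOnWith (γ : Curve X) : LipschitzOnWith 1 γ.toFun (Icc 0 γ.len) := by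
  have key : ∀ x ∈ Icc 0 γ.len, ∀ y ∈ Icc 0 γ.len, x ≤ y →
      edist (γ.toFun x) (γ.toFun y) ≤ edist x y := by
    intro x hx y hy hxy
    have h := γ.unitSpeed hx hy
    have h2 : edist (γ.toFun x) (γ.toFun y) ≤ eVariationOn γ.toFun (Icc 0 γ.len ∩ Icc x y) :=
      eVariationOn.edist_le _ ⟨hx, left_mem_Icc.2 hxy⟩ ⟨hy, right_mem_Icc.2 hxy⟩
    rw [h] at h2
    rw [edist_comm x y, edist_dist y x, Real.dist_eq, abs_of_nonneg (sub_nonneg.2 hxy)]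
    simpa using h2
  intro x hx y hy
  rw [ENNReal.coe_one, one_mul]
  rcases le_total x y with h | h
  · exact key x hx y hy h
  · rw [edist_comm, edist_comm x y]; exact key y hy x hx h

lemma Curve.continuousOn (γ : Curve X) : ContinuousOn γ.toFun (Icc 0 γ.len) :=
  γ.lipschitzOnWith.continuousOn

lemma Curve.isCompact_image (γ : Curve X) : IsCompact (γ.toFun '' Icc 0 γ.len) :=
  isCompact_Icc.image_of_continuousOn γ.continuousOn

lemma Curve.liesIn_sub {γ : Curve X} {U : Set X} {s t : ℝ} (hs : 0 ≤ s) (hst : s < t)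
    (ht : t ≤ γ.len) :
    (γ.sub s t hs hst ht).LiesIn U ↔ ∀ r ∈ Icc s t, γ.toFun r ∈ U := by
  constructor
  · intro h r hr
    have := h (r - s) ⟨by linarith [hr.1], by simpa [Curve.sub] using hr.2⟩
    simpa [Curve.sub] using this
  · intro h r hr
    exact h (s + r) ⟨by linarith [hr.1], by have := hr.2; simp only [Curve.sub] at this; linarith⟩

lemma Curve.integral_sub (γ : Curve X) {s t : ℝ} (hs : 0 ≤ s) (hst : s < t) (ht : t ≤ γ.len)
    (g : X → ℝ≥0∞) :
    (γ.sub s t hs hst ht).integral g = ∫⁻ r in Icc s t, g (γ.toFun r) := by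
  have hm : MeasurePreserving (fun r : ℝ => s + r) volume volume :=
    measurePreserving_add_left volume s
  have he : MeasurableEmbedding (fun r : ℝ => s + r) :=
    (MeasurableEquiv.addLeft s).measurableEmbedding
  have := hm.setLIntegral_comp_preimage_emb he (fun r => g (γ.toFun r)) (Icc s t)
  rw [← this]
  unfold Curve.integral
  simp [Curve.sub]

lemma Curve.integral_mono (γ : Curve X) {g h : X → ℝ≥0∞} (hgh : ∀ x, g x ≤ h x) :
    γ.integral g ≤ γ.integral h := lintegral_mono fun _ => hgh _

lemma Curve.integral_sub_le (γ : Curve X) {s t : ℝ} (hs : 0 ≤ s) (hst : s < t) (ht : t ≤ γ.len)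
    (g : X → ℝ≥0∞) : (γ.sub s t hs hst ht).integral g ≤ γ.integral g := by
  rw [γ.integral_sub]
  exact lintegral_mono_set (Icc_subset_Icc hs ht)

lemma upperGradientIneq_of_integral_eq_top {u : X → EReal} {g : X → ℝ≥0∞} {γ : Curve X}
    (h : γ.integral g = ∞) : UpperGradientIneq u g γ :=
  ⟨fun _ _ _ _ => h ▸ le_top, fun _ => h⟩

lemma UpperGradientIneq.mono {u : X → EReal} {g h : X → ℝ≥0∞} {γ : Curve X}
    (hu : UpperGradientIneq u g γ) (hgh : ∀ x, g x ≤ h x) : UpperGradientIneq u h γ :=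
  ⟨fun s t hs ht => (hu.1 s t hs ht).trans (γ.integral_mono hgh),
    fun hi => top_le_iff.1 ((hu.2 hi).symm.le.trans (γ.integral_mono hgh))⟩

/-! ### Exceptional families of curves -/

variable [MeasurableSpace X] [BorelSpace X]

lemma Curve.aemeasurable (γ : Curve X) :
    AEMeasurable γ.toFun (volume.restrict (Icc 0 γ.len)) :=
  γ.continuousOn.aemeasurable measurableSet_Icc

lemma Curve.aemeasurable_comp (γ : Curve X) {g : X → ℝ≥0∞} (hg : Measurable g) :
    AEMeasurable (fun t => g (γ.toFun t)) (volume.restrict (Icc 0 γ.len)) :=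
  hg.comp_aemeasurable γ.aemeasurable

lemma Curve.integral_const_mul (γ : Curve X) {g : X → ℝ≥0∞} (hg : Measurable g) (c : ℝ≥0∞) :
    γ.integral (fun x => c * g x) = c * γ.integral g :=
  lintegral_const_mul'' _ (γ.aemeasurable_comp hg)

/-- A family of curves is `1`-exceptional iff a single integrable Borel function has infinite
integral along each of its members. -/
lemma modulus_eq_zero_iff {μ : Measure X} {Γ : Set (Curve X)} :
    modulus μ Γ = 0 ↔
      ∃ r : X → ℝ≥0∞, Measurable r ∧ ∫⁻ x, r x ∂μ < ∞ ∧ ∀ γ ∈ Γ, γ.integral r = ∞ := by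
  constructor
  · intro h
    have hn : ∀ n : ℕ, ∃ r : X → ℝ≥0∞, Measurable r ∧ (∀ γ ∈ Γ, 1 ≤ γ.integral r) ∧
        ∫⁻ x, r x ∂μ < 2⁻¹ ^ n := by
      intro n
      have : modulus μ Γ < 2⁻¹ ^ n := by
        rw [h]; exact ENNReal.pow_pos (by simp) n
      simpa only [modulus, iInf_lt_iff, exists_prop] using this
    choose r hr h1 h2 using hn
    refine ⟨fun x => ∑' n, r n x, Measurable.tsum hr, ?_, ?_⟩
    · rw [lintegral_tsum fun n => (hr n).aemeasurable]
      refine (ENNReal.tsum_le_tsum fun n => (h2 n).le).trans_lt ?_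
      rw [ENNReal.tsum_geometric]
      simp
    · intro γ hγ
      unfold Curve.integral
      rw [lintegral_tsum fun n => γ.aemeasurable_comp (hr n)]
      refine top_le_iff.1 (le_trans ?_ (ENNReal.tsum_le_tsum fun n => h1 n γ hγ))
      rw [ENNReal.tsum_const_eq_top_of_ne_zero one_ne_zero]
  · rintro ⟨r, hr, hfin, hΓ⟩
    refine le_antisymm (le_of_forall_gt fun ε hε => ?_) zero_le
    -- a small positive multiple of `r` is still admissible
    obtain ⟨c, hc0, hc⟩ : ∃ c : ℝ≥0∞, c ≠ 0 ∧ c * ∫⁻ x, r x ∂μ < ε := by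
      obtain ⟨c, hc0, hc⟩ := ENNReal.exists_nnreal_pos_mul_lt hfin.ne hε.ne'
      exact ⟨c, by exact_mod_cast hc0.ne', hc⟩
    refine lt_of_le_of_lt ?_ hc
    refine iInf_le_of_le (fun x => c * r x) (iInf_le_of_le (hr.const_mul c) (iInf_le_of_le ?_ ?_))
    · intro γ hγ
      rw [γ.integral_const_mul hr, hΓ γ hγ, ENNReal.mul_top hc0]
      exact le_top
    · rw [lintegral_const_mul _ hr]

/-- The filter of families of curves whose complement has zero `1`-modulus: a property holds
eventually along `curveAE μ` iff it holds for `1`-almost every curve. -/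
def curveAE (μ : Measure X) : Filter (Curve X) :=
  Filter.ofCountableUnion {Γ | modulus μ Γ = 0}
    (by
      intro S hS h
      have h' : ∀ Γ ∈ S, ∃ r : X → ℝ≥0∞, Measurable r ∧ ∫⁻ x, r x ∂μ < ∞ ∧
          ∀ γ ∈ Γ, γ.integral r = ∞ := fun Γ hΓ => modulus_eq_zero_iff.1 (h Γ hΓ)
      choose! r hr hfin htop using h'
      have := hS.to_subtype
      obtain ⟨δ, hδ0, hδ⟩ := ENNReal.exists_pos_sum_of_countable' one_ne_zero S
      have hc : ∀ Γ : S, ∃ c : ℝ≥0∞, c ≠ 0 ∧ c * ∫⁻ x, r Γ x ∂μ < δ Γ := by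
        intro Γ
        obtain ⟨c, hc0, hc⟩ := ENNReal.exists_nnreal_pos_mul_lt (hfin Γ Γ.2).ne (hδ0 Γ).ne'
        exact ⟨c, by exact_mod_cast hc0.ne', hc⟩
      choose c hc0 hc using hc
      refine modulus_eq_zero_iff.2 ⟨fun x => ∑' Γ : S, c Γ * r Γ x,
        Measurable.tsum fun Γ => (hr Γ Γ.2).const_mul _, ?_, ?_⟩
      · rw [lintegral_tsum fun Γ : S => ((hr Γ Γ.2).const_mul _).aemeasurable]
        refine lt_of_le_of_lt (ENNReal.tsum_le_tsum fun Γ => ?_) (hδ.trans ENNReal.one_lt_top)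
        rw [lintegral_const_mul _ (hr Γ Γ.2)]
        exact (hc Γ).le
      · rintro γ ⟨Γ, hΓ, hγ⟩
        refine top_le_iff.1 ?_
        calc ∞ = γ.integral (fun x => c ⟨Γ, hΓ⟩ * r Γ x) := by
              rw [γ.integral_const_mul (hr Γ hΓ), htop Γ hΓ γ hγ, ENNReal.mul_top (hc0 _)]
          _ ≤ _ := γ.integral_mono fun x =>
              ENNReal.le_tsum (f := fun Γ : S => c Γ * r Γ x) ⟨Γ, hΓ⟩)
    (by
      intro t ht s hst
      obtain ⟨r, hr, hfin, htop⟩ := modulus_eq_zero_iff.1 ht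
      exact modulus_eq_zero_iff.2 ⟨r, hr, hfin, fun γ hγ => htop γ (hst hγ)⟩)

instance (μ : Measure X) : CountableInterFilter (curveAE μ) :=
  Filter.countableInter_ofCountableUnion _ _ _

lemma eventually_curveAE {μ : Measure X} {P : Curve X → Prop} :
    (∀ᶠ γ in curveAE μ, P γ) ↔
      ∃ r : X → ℝ≥0∞, Measurable r ∧ ∫⁻ x, r x ∂μ < ∞ ∧ ∀ γ, ¬ P γ → γ.integral r = ∞ := by
  rw [show (∀ᶠ γ in curveAE μ, P γ) ↔ modulus μ {γ | P γ}ᶜ = 0 from Iff.rfl, modulus_eq_zero_iff]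
  rfl

lemma isWeakUpperGradient_iff {μ : Measure X} {U : Set X} {u : X → EReal} {g : X → ℝ≥0∞} :
    IsWeakUpperGradient μ U u g ↔ Measurable g ∧
      ∀ᶠ γ in curveAE μ, γ.LiesIn U → UpperGradientIneq u g γ := by
  rw [IsWeakUpperGradient, eventually_curveAE, modulus_eq_zero_iff]
  simp [Classical.not_imp]

/-- Almost every curve has only good sub-curves. -/
lemma eventually_curveAE_sub {μ : Measure X} {P : Curve X → Prop}
    (h : ∀ᶠ γ in curveAE μ, P γ) :
    ∀ᶠ γ in curveAE μ, ∀ (s t : ℝ) (hs : 0 ≤ s) (hst : s < t) (ht : t ≤ γ.len),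
      P (γ.sub s t hs hst ht) := by
  obtain ⟨r, hr, hfin, htop⟩ := eventually_curveAE.1 h
  refine eventually_curveAE.2 ⟨r, hr, hfin, fun γ hγ => ?_⟩
  push Not at hγ
  obtain ⟨s, t, hs, hst, ht, hP⟩ := hγ
  exact top_le_iff.1 ((htop _ hP).symm.le.trans (γ.integral_sub_le hs hst ht r))

lemma eventually_curveAE_integral_lt_top {μ : Measure X} {g : X → ℝ≥0∞} (hg : Measurable g)
    (hfin : ∫⁻ x, g x ∂μ < ∞) : ∀ᶠ γ in curveAE μ, γ.integral g < ∞ :=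
  eventually_curveAE.2 ⟨g, hg, hfin, fun γ hγ => by simpa using hγ⟩

/-- Almost every curve spends no time in a given null set. -/
lemma eventually_curveAE_of_ae {μ : Measure X} {P : X → Prop} (h : ∀ᵐ x ∂μ, P x) :
    ∀ᶠ γ in curveAE μ, ∀ᵐ t ∂(volume.restrict (Icc 0 γ.len)), P (γ.toFun t) := by
  obtain ⟨E, hE, hEm, hE0⟩ := exists_measurable_superset_of_null (ae_iff.1 h)
  refine eventually_curveAE.2
    ⟨E.indicator fun _ => ∞, measurable_const.indicator hEm, ?_, fun γ hγ => ?_⟩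
  · rw [lintegral_indicator hEm]
    simp [hE0]
  · by_contra hne
    apply hγ
    have hm : Measurable (E.indicator fun _ => (∞ : ℝ≥0∞)) := measurable_const.indicator hEm
    have := ae_lt_top' (γ.aemeasurable_comp hm) hne
    filter_upwards [this] with t ht
    by_contra hP
    have : γ.toFun t ∈ E := hE hP
    simp [this] at ht

lemma eventually_curveAE_of_ae_restrict {μ : Measure X} {U : Set X} (hU : MeasurableSet U)
    {P : X → Prop} (h : ∀ᵐ x ∂μ.restrict U, P x) :
    ∀ᶠ γ in curveAE μ, ∀ᵐ t ∂(volume.restrict (Icc 0 γ.len)), γ.toFun t ∈ U → P (γ.toFun t) :=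
  eventually_curveAE_of_ae (P := fun x => x ∈ U → P x) ((ae_restrict_iff' hU).1 h)

end

section

/-! ### Absolutely continuous functions on an interval -/

lemma absolutelyContinuousOnInterval_of_dist_le {f g : ℝ → ℝ} {a b : ℝ}
    (hg : AbsolutelyContinuousOnInterval g a b)
    (h : ∀ s ∈ uIcc a b, ∀ t ∈ uIcc a b, dist (f s) (f t) ≤ dist (g s) (g t)) :
    AbsolutelyContinuousOnInterval f a b := by
  rw [absolutelyContinuousOnInterval_iff] at hg ⊢
  intro ε hε
  obtain ⟨δ, hδ, H⟩ := hg ε hε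
  refine ⟨δ, hδ, fun E hE hEδ => lt_of_le_of_lt (Finset.sum_le_sum fun i hi => ?_) (H E hE hEδ)⟩
  exact h _ (hE.1 i hi).1 _ (hE.1 i hi).2

lemma lintegral_Icc_eq_ofReal_intervalIntegral {a b s t : ℝ} {h : ℝ → ℝ≥0∞}
    (hm : AEMeasurable h (volume.restrict (Icc a b))) (hfin : ∫⁻ r in Icc a b, h r < ∞)
    (has : a ≤ s) (hst : s ≤ t) (htb : t ≤ b) :
    ∫⁻ r in Icc s t, h r = ENNReal.ofReal (∫ r in s..t, (h r).toReal) := by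
  have hsub : Icc s t ⊆ Icc a b := Icc_subset_Icc has htb
  have hm' : AEMeasurable h (volume.restrict (Icc s t)) :=
    hm.mono_measure (Measure.restrict_mono hsub le_rfl)
  have hfin' : ∫⁻ r in Icc s t, h r < ∞ := (lintegral_mono_set hsub).trans_lt hfin
  rw [intervalIntegral.integral_of_le hst, ← integral_Icc_eq_integral_Ioc,
    integral_toReal hm' (ae_lt_top' hm' hfin'.ne), ENNReal.ofReal_toReal hfin'.ne]

lemma intervalIntegrable_toReal {a b : ℝ} {h : ℝ → ℝ≥0∞} (hab : a ≤ b)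
    (hm : AEMeasurable h (volume.restrict (Icc a b))) (hfin : ∫⁻ r in Icc a b, h r < ∞) :
    IntervalIntegrable (fun r => (h r).toReal) volume a b := by
  rw [intervalIntegrable_iff_integrableOn_Icc_of_le hab]
  exact integrable_toReal_of_lintegral_ne_top hm hfin.ne

section Majorant

variable {a b : ℝ} {f : ℝ → ℝ} {h : ℝ → ℝ≥0∞}

lemma dist_le_dist_intervalIntegral (hab : a ≤ b)
    (hm : AEMeasurable h (volume.restrict (Icc a b))) (hfin : ∫⁻ r in Icc a b, h r < ∞)
    (hf : ∀ s t, a ≤ s → s < t → t ≤ b → ENNReal.ofReal |f s - f t| ≤ ∫⁻ r in Icc s t, h r)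
    {s t : ℝ} (hs : s ∈ Icc a b) (ht : t ∈ Icc a b) :
    dist (f s) (f t) ≤ dist (∫ r in a..s, (h r).toReal) (∫ r in a..t, (h r).toReal) := by
  wlog hst : s < t generalizing s t
  · rcases (not_lt.1 hst).eq_or_lt with rfl | h'
    · simp
    · rw [dist_comm, dist_comm (∫ r in a..s, (h r).toReal)]
      exact this ht hs h'
  have hint := intervalIntegrable_toReal hab hm hfin
  have hi : ∀ c ∈ Icc a b, IntervalIntegrable (fun r => (h r).toReal) volume a c := fun c hc =>
    hint.mono_set (by rw [uIcc_of_le hc.1, uIcc_of_le hab]; exact Icc_subset_Icc le_rfl hc.2)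
  have h1 := hf s t hs.1 hst ht.2
  rw [lintegral_Icc_eq_ofReal_intervalIntegral hm hfin hs.1 hst.le ht.2] at h1
  have hnn : 0 ≤ ∫ r in s..t, (h r).toReal :=
    intervalIntegral.integral_nonneg hst.le fun _ _ => ENNReal.toReal_nonneg
  rw [dist_comm (∫ r in a..s, (h r).toReal), Real.dist_eq, Real.dist_eq,
    intervalIntegral.integral_interval_sub_left (hi t ht) (hi s hs), abs_of_nonneg hnn]
  exact (ENNReal.ofReal_le_ofReal_iff hnn).1 h1

/-- A function whose increments are dominated by the integrals of an integrable `h` is absolutely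
continuous. -/
lemma absolutelyContinuousOnInterval_of_le_lintegral (hab : a ≤ b)
    (hm : AEMeasurable h (volume.restrict (Icc a b))) (hfin : ∫⁻ r in Icc a b, h r < ∞)
    (hf : ∀ s t, a ≤ s → s < t → t ≤ b → ENNReal.ofReal |f s - f t| ≤ ∫⁻ r in Icc s t, h r) :
    AbsolutelyContinuousOnInterval f a b := by
  refine absolutelyContinuousOnInterval_of_dist_le
    ((intervalIntegrable_toReal hab hm hfin).absolutelyContinuousOnInterval_intervalIntegral
      (c := a) left_mem_uIcc) ?_
  rw [uIcc_of_le hab]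
  exact fun s hs t ht => dist_le_dist_intervalIntegral hab hm hfin hf hs ht

/-- A function whose increments are dominated by the integrals of an integrable `h` satisfies
`|f'| ≤ h` almost everywhere, by Lebesgue's differentiation theorem. -/
lemma ae_deriv_le_of_le_lintegral (hab : a ≤ b)
    (hm : AEMeasurable h (volume.restrict (Icc a b))) (hfin : ∫⁻ r in Icc a b, h r < ∞)
    (hf : ∀ s t, a ≤ s → s < t → t ≤ b → ENNReal.ofReal |f s - f t| ≤ ∫⁻ r in Icc s t, h r) :
    ∀ᵐ t ∂(volume.restrict (Icc a b)), ENNReal.ofReal |deriv f t| ≤ h t := by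
  have hac := absolutelyContinuousOnInterval_of_le_lintegral hab hm hfin hf
  have hint := intervalIntegrable_toReal hab hm hfin
  rw [ae_restrict_iff' measurableSet_Icc]
  have ha : ∀ᵐ x : ℝ, x ≠ a := by simp [ae_iff, measure_singleton]
  have hb : ∀ᵐ x : ℝ, x ≠ b := by simp [ae_iff, measure_singleton]
  filter_upwards [hac.ae_differentiableAt, hint.ae_hasDerivAt_integral, ha, hb]
    with t h1 h2 hta htb ht
  rw [uIcc_of_le hab] at h1 h2
  have hd := (h1 ht).hasDerivAt
  have hD := h2 ht a (left_mem_Icc.2 hab)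
  have hnb : Icc a b ∈ 𝓝 t :=
    Icc_mem_nhds (lt_of_le_of_ne ht.1 hta.symm) (lt_of_le_of_ne ht.2 htb)
  have hle : |deriv f t| ≤ |(h t).toReal| := by
    have t1 := (hasDerivAt_iff_tendsto_slope.1 hd).abs
    have t2 := (hasDerivAt_iff_tendsto_slope.1 hD).abs
    refine le_of_tendsto_of_tendsto t1 t2 ?_
    filter_upwards [mem_nhdsWithin_of_mem_nhds hnb] with r hr
    simp only [slope_def_field, abs_div]
    refine div_le_div_of_nonneg_right ?_ (abs_nonneg _)
    have := dist_le_dist_intervalIntegral hab hm hfin hf hr ht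
    simpa [Real.dist_eq] using this
  refine (ENNReal.ofReal_le_ofReal hle).trans ?_
  rw [abs_of_nonneg ENNReal.toReal_nonneg]
  exact ENNReal.ofReal_toReal_le

lemma le_lintegral_of_ae_deriv_le (hab : a ≤ b) (hf : AbsolutelyContinuousOnInterval f a b)
    (hd : ∀ᵐ t ∂(volume.restrict (Icc a b)), ENNReal.ofReal |deriv f t| ≤ h t) :
    ENNReal.ofReal |f a - f b| ≤ ∫⁻ r in Icc a b, h r := by
  rw [abs_sub_comm, ← hf.integral_deriv_eq_sub, intervalIntegral.integral_of_le hab,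
    ← integral_Icc_eq_integral_Ioc, ← Real.norm_eq_abs, ofReal_norm]
  refine (enorm_integral_le_lintegral_enorm _).trans (lintegral_mono_ae ?_)
  filter_upwards [hd] with t ht
  rwa [← ofReal_norm, Real.norm_eq_abs]

end Majorant

end

section

variable {X : Type*} [MetricSpace X]

/-! ### Doubling measures and exhaustions -/

/-- An open subset of a proper space is exhausted by open sets `V n ⋐ U`. -/
lemma exists_open_exhaustion [ProperSpace X] {U : Set X} (hU : IsOpen U) :
    ∃ V : ℕ → Set X, (∀ n, IsOpen (V n)) ∧ (∀ n, CompactlyIn (V n) U) ∧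
      ∀ K, IsCompact K → K ⊆ U → ∃ n, K ⊆ V n := by
  rcases isEmpty_or_nonempty X with hX | ⟨⟨x₀⟩⟩
  · exact ⟨fun _ => ∅, by simp, by simp [CompactlyIn], fun K _ _ =>
      ⟨0, fun x => (hX.false x).elim⟩⟩
  have hcont : ∀ n : ℕ, IsClosed {x : X | ((n : ℝ≥0∞) + 1)⁻¹ ≤ Metric.infEDist x Uᶜ} := fun n =>
    isClosed_le continuous_const Metric.continuous_infEDist
  have hsub : ∀ n : ℕ, closure ({x : X | ((n : ℝ≥0∞) + 1)⁻¹ < Metric.infEDist x Uᶜ} ∩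
      Metric.ball x₀ n) ⊆ {x : X | ((n : ℝ≥0∞) + 1)⁻¹ ≤ Metric.infEDist x Uᶜ} ∩
      Metric.closedBall x₀ n := fun n =>
    closure_minimal (inter_subset_inter (fun x hx => le_of_lt (mem_ofPred_eq.mp hx))
        Metric.ball_subset_closedBall)
      ((hcont n).inter Metric.isClosed_closedBall)
  refine ⟨fun n => {x : X | ((n : ℝ≥0∞) + 1)⁻¹ < Metric.infEDist x Uᶜ} ∩ Metric.ball x₀ n,
    fun n => (isOpen_lt continuous_const Metric.continuous_infEDist).inter Metric.isOpen_ball,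
    fun n => ⟨?_, ?_⟩, ?_⟩
  · exact (isCompact_closedBall x₀ (n : ℝ)).of_isClosed_subset isClosed_closure
      ((hsub n).trans inter_subset_right)
  · intro x hx
    by_contra hxU
    have h1 : ((n : ℝ≥0∞) + 1)⁻¹ ≤ Metric.infEDist x Uᶜ := (hsub n hx).1
    rw [Metric.infEDist_zero_of_mem (show x ∈ Uᶜ from hxU)] at h1
    simp at h1
  · intro K hK hKU
    obtain ⟨δ, hδ, hδU⟩ := hK.exists_thickening_subset_open hU hKU
    obtain ⟨n1, hn1⟩ := ENNReal.exists_inv_nat_lt (ENNReal.ofReal_pos.2 hδ).ne'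
    obtain ⟨R, hR⟩ := hK.isBounded.subset_ball x₀
    obtain ⟨n2, hn2⟩ := exists_nat_gt R
    refine ⟨max n1 n2, fun x hx => ⟨?_, ?_⟩⟩
    · have h1 : ENNReal.ofReal δ ≤ Metric.infEDist x Uᶜ := by
        rw [Metric.le_infEDist]
        intro y hy
        by_contra! hlt
        refine hy (hδU ?_)
        rw [Metric.mem_thickening_iff_exists_edist_lt]
        exact ⟨x, hx, by rwa [edist_comm]⟩
      refine lt_of_lt_of_le (lt_of_le_of_lt (ENNReal.inv_le_inv.2 ?_) hn1) h1
      refine le_trans ?_ le_self_add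
      exact_mod_cast le_max_left n1 n2
    · refine Metric.ball_subset_ball ?_ (hR hx)
      refine hn2.le.trans ?_
      exact_mod_cast le_max_right n1 n2

variable [MeasurableSpace X]

lemma IsDoubling.measure_ball_lt_top {μ : Measure X} (hμ : IsDoubling μ) (x : X) (r : ℝ) :
    μ (Metric.ball x r) < ∞ := by
  obtain ⟨CD, hCD, h⟩ := hμ
  rcases le_or_gt r 0 with hr | hr
  · simp [Metric.ball_eq_empty.2 hr]
  · have := (h x (r / 2) (by positivity)).2
    rw [mul_div_cancel₀ r two_ne_zero] at this
    exact this.1.trans_lt this.2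

lemma LocallyFiniteIntegral.mono {μ : Measure X} {U : Set X} {g h : X → ℝ≥0∞}
    (hg : LocallyFiniteIntegral μ U g) (hle : ∀ᵐ x ∂μ.restrict U, h x ≤ g x) :
    LocallyFiniteIntegral μ U h := by
  intro V hVo hV
  refine lt_of_le_of_lt (lintegral_mono_ae ?_) (hg V hVo hV)
  exact ae_restrict_of_ae_restrict_of_subset (subset_closure.trans hV.2) hle

lemma LocallyFiniteIntegral.of_lintegral_lt_top {μ : Measure X} {U : Set X} {g : X → ℝ≥0∞}
    (h : ∫⁻ x in U, g x ∂μ < ∞) :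
    LocallyFiniteIntegral μ U g := fun _ _ hV =>
  (lintegral_mono_set (subset_closure.trans hV.2)).trans_lt h

variable [BorelSpace X]

/-- A complete space carrying a doubling measure is proper: separated points of a ball are centres
of disjoint balls whose measures are bounded below, so there are finitely many of them. -/
lemma IsDoubling.properSpace [CompleteSpace X] {μ : Measure X} (hμ : IsDoubling μ) :
    ProperSpace X := by
  refine ProperSpace.of_isCompact_closedBall_of_le 0 fun x r hr => ?_
  refine TotallyBounded.isCompact_of_isClosed ?_ Metric.isClosed_closedBall
  rw [Metric.totallyBounded_iff]
  by_contra! hcon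
  obtain ⟨ε, hε, hcon⟩ := hcon
  have : Std.Symm (fun y z : X => ε ≤ dist y z) := ⟨fun a b h => by rwa [dist_comm]⟩
  obtain ⟨f, hf1, hf2⟩ := exists_seq_of_forall_finset_exists'
    (fun y => y ∈ Metric.closedBall x r) (fun y z => ε ≤ dist y z) (by
      intro s _
      have := hcon (s : Set X) s.finite_toSet
      rw [not_subset] at this
      obtain ⟨z, hz, hz'⟩ := this
      refine ⟨z, hz, fun y hy => ?_⟩
      simp only [mem_iUnion, Metric.mem_ball, not_exists, not_lt] at hz'
      rw [dist_comm]
      exact hz' y hy)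
  have hfin := hμ.measure_ball_lt_top x (r + ε)
  obtain ⟨CD, hCD, h⟩ := hμ
  have hpow : ∀ (y : X) (n : ℕ),
      μ (Metric.ball y (2 ^ n * (ε / 2))) ≤ ENNReal.ofReal CD ^ n * μ (Metric.ball y (ε / 2)) := by
    intro y n
    induction n with
    | zero => simp
    | succ n ih =>
      calc μ (Metric.ball y (2 ^ (n + 1) * (ε / 2)))
          = μ (Metric.ball y (2 * (2 ^ n * (ε / 2)))) := by ring_nf
        _ ≤ ENNReal.ofReal CD * μ (Metric.ball y (2 ^ n * (ε / 2))) :=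
            (h y _ (by positivity)).2.1
        _ ≤ ENNReal.ofReal CD * (ENNReal.ofReal CD ^ n * μ (Metric.ball y (ε / 2))) := by gcongr
        _ = _ := by ring
  obtain ⟨n, hn⟩ : ∃ n : ℕ, (2 * r + 1) / (ε / 2) < 2 ^ n := pow_unbounded_of_one_lt _ one_lt_two
  rw [div_lt_iff₀ (by positivity)] at hn
  have hC0 : ENNReal.ofReal CD ^ n ≠ 0 :=
    pow_ne_zero _ (by simpa using zero_lt_one.trans_le hCD)
  have hCt : ENNReal.ofReal CD ^ n ≠ ∞ := ENNReal.pow_ne_top ENNReal.ofReal_ne_top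
  have hc0 : 0 < μ (Metric.ball x (r + 1)) := by
    have := (h x ((r + 1) / 2) (by positivity)).1
    rwa [mul_div_cancel₀ _ two_ne_zero] at this
  set c : ℝ≥0∞ := μ (Metric.ball x (r + 1)) / ENNReal.ofReal CD ^ n with hc
  have hcpos : 0 < c := ENNReal.div_pos hc0.ne' hCt
  have hlow : ∀ i, c ≤ μ (Metric.ball (f i) (ε / 2)) := by
    intro i
    rw [hc, ENNReal.div_le_iff hC0 hCt, mul_comm]
    refine (measure_mono ?_).trans (hpow (f i) n)
    refine Metric.ball_subset_ball' ?_
    have : dist x (f i) ≤ r := by rw [dist_comm]; exact hf1 i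
    linarith
  have hfinite := Measure.finite_const_le_meas_of_disjoint_iUnion μ hcpos
    (As := fun i => Metric.ball (f i) (ε / 2)) (fun i => measurableSet_ball)
    (fun i j hij => Metric.ball_disjoint_ball (by have := hf2 hij; linarith))
    (ne_top_of_le_ne_top hfin.ne (measure_mono (iUnion_subset fun i =>
      Metric.ball_subset_ball' (by have := Metric.mem_closedBall.1 (hf1 i); linarith))))
  have huniv : {i : ℕ | c ≤ μ (Metric.ball (f i) (ε / 2))} = univ :=
    eq_univ_of_forall hlow
  rw [huniv] at hfinite
  exact infinite_univ hfinite

/-! ### Regularity along curves -/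

/-- `u` is finite and absolutely continuous along the curve `γ`. -/
def RegularAlong (u : X → EReal) (γ : Curve X) : Prop :=
  (∀ t ∈ Icc 0 γ.len, ∃ r : ℝ, u (γ.toFun t) = r) ∧
    AbsolutelyContinuousOnInterval (fun t => (u (γ.toFun t)).toReal) 0 γ.len

/-- If `u` satisfies the upper gradient inequality on all sub-curves of a piece of a curve along
which `g` is integrable, then it is absolutely continuous there, with derivative bounded by `g`. -/
lemma regular_of_upperGradientIneq {u : X → EReal} {g : X → ℝ≥0∞} (hg : Measurable g)
    {γ : Curve X} {a b : ℝ} (ha : 0 ≤ a) (hab : a < b) (hb : b ≤ γ.len)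
    (hfin : ∫⁻ t in Icc a b, g (γ.toFun t) < ∞)
    (h : ∀ (s t : ℝ) (hs : a ≤ s) (hst : s < t) (ht : t ≤ b),
      UpperGradientIneq u g (γ.sub s t (ha.trans hs) hst (ht.trans hb))) :
    (∀ t ∈ Icc a b, ∃ r : ℝ, u (γ.toFun t) = r) ∧
    AbsolutelyContinuousOnInterval (fun t => (u (γ.toFun t)).toReal) a b ∧
    ∀ᵐ t ∂(volume.restrict (Icc a b)),
      ENNReal.ofReal |deriv (fun t => (u (γ.toFun t)).toReal) t| ≤ g (γ.toFun t) := by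
  have hsubfin : ∀ s t (hs : a ≤ s) (hst : s < t) (ht : t ≤ b),
      (γ.sub s t (ha.trans hs) hst (ht.trans hb)).integral g ≠ ∞ := by
    intro s t hs hst ht
    rw [γ.integral_sub]
    exact ((lintegral_mono_set (Icc_subset_Icc hs ht)).trans_lt hfin).ne
  have hreal : ∀ t ∈ Icc a b, ∃ r : ℝ, u (γ.toFun t) = r := by
    intro t ht
    by_contra hne
    rcases ht.2.eq_or_lt with rfl | htb
    · refine hsubfin a t le_rfl hab le_rfl ((h a t le_rfl hab le_rfl).2 (Or.inr ?_))
      simpa [Curve.sub] using hne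
    · refine hsubfin t b ht.1 htb le_rfl ((h t b ht.1 htb le_rfl).2 (Or.inl ?_))
      simpa [Curve.sub] using hne
  have hineq : ∀ s t, a ≤ s → s < t → t ≤ b →
      ENNReal.ofReal |(u (γ.toFun s)).toReal - (u (γ.toFun t)).toReal| ≤
        ∫⁻ r in Icc s t, g (γ.toFun r) := by
    intro s t hs hst ht
    obtain ⟨x, hx⟩ := hreal s ⟨hs, hst.le.trans ht⟩
    obtain ⟨y, hy⟩ := hreal t ⟨hs.trans hst.le, ht⟩
    have := (h s t hs hst ht).1 x y (by simpa [Curve.sub] using hx) (by simpa [Curve.sub] using hy)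
    rw [γ.integral_sub] at this
    rwa [hx, hy, EReal.toReal_coe, EReal.toReal_coe]
  have hm : AEMeasurable (fun t => g (γ.toFun t)) (volume.restrict (Icc a b)) :=
    (γ.aemeasurable_comp hg).mono_measure (Measure.restrict_mono (Icc_subset_Icc ha hb) le_rfl)
  exact ⟨hreal, absolutelyContinuousOnInterval_of_le_lintegral hab.le hm hfin hineq,
    ae_deriv_le_of_le_lintegral hab.le hm hfin hineq⟩

variable {μ : Measure X} {U : Set X} {u : X → EReal} {g : X → ℝ≥0∞}

lemma eventually_curveAE_integral_lt_top_of_locallyFinite [ProperSpace X] (hU : IsOpen U)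
    (hg : Measurable g) (hfin : LocallyFiniteIntegral μ U g) :
    ∀ᶠ γ in curveAE μ, γ.LiesIn U → γ.integral g < ∞ := by
  obtain ⟨V, hVo, hVc, hV⟩ := exists_open_exhaustion hU
  have h : ∀ n, ∀ᶠ γ in curveAE μ, γ.integral ((V n).indicator g) < ∞ := by
    intro n
    refine eventually_curveAE_integral_lt_top (hg.indicator (hVo n).measurableSet) ?_
    rw [lintegral_indicator (hVo n).measurableSet]
    exact hfin _ (hVo n) (hVc n)
  filter_upwards [eventually_countable_forall.2 h] with γ hγ hγU
  obtain ⟨n, hn⟩ := hV _ γ.isCompact_image (image_subset_iff.2 hγU)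
  refine lt_of_le_of_lt (le_of_eq ?_) (hγ n)
  refine setLIntegral_congr_fun measurableSet_Icc fun t ht => ?_
  rw [indicator_of_mem (hn (mem_image_of_mem _ ht))]

lemma IsWeakUpperGradient.eventually_regular_sub [ProperSpace X] (hU : IsOpen U)
    (h : IsWeakUpperGradient μ U u g) (hfin : LocallyFiniteIntegral μ U g) :
    ∀ᶠ γ in curveAE μ, ∀ a b, 0 ≤ a → a < b → b ≤ γ.len → (∀ t ∈ Icc a b, γ.toFun t ∈ U) →
      (∀ t ∈ Icc a b, ∃ r : ℝ, u (γ.toFun t) = r) ∧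
      AbsolutelyContinuousOnInterval (fun t => (u (γ.toFun t)).toReal) a b ∧
      ∀ᵐ t ∂(volume.restrict (Icc a b)),
        ENNReal.ofReal |deriv (fun t => (u (γ.toFun t)).toReal) t| ≤ g (γ.toFun t) := by
  have hg := (isWeakUpperGradient_iff.1 h).1
  filter_upwards [eventually_curveAE_sub (isWeakUpperGradient_iff.1 h).2,
    eventually_curveAE_sub (eventually_curveAE_integral_lt_top_of_locallyFinite hU hg hfin)]
    with γ h1 h2 a b ha hab hb hγ
  refine regular_of_upperGradientIneq hg ha hab hb ?_ fun s t hs hst ht => ?_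
  · rw [← γ.integral_sub ha hab hb]
    exact h2 a b ha hab hb ((Curve.liesIn_sub ha hab hb).2 hγ)
  · exact h1 _ _ _ _ _ ((Curve.liesIn_sub _ _ _).2 fun r hr => hγ r ⟨hs.trans hr.1, hr.2.trans ht⟩)

lemma IsWeakUpperGradient.eventually_regularAlong [ProperSpace X] (hU : IsOpen U)
    (h : IsWeakUpperGradient μ U u g) (hfin : LocallyFiniteIntegral μ U g) :
    ∀ᶠ γ in curveAE μ, γ.LiesIn U → RegularAlong u γ := by
  filter_upwards [h.eventually_regular_sub hU hfin] with γ hγ hγU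
  have := hγ 0 γ.len le_rfl γ.len_pos le_rfl hγU
  exact ⟨this.1, this.2.1⟩

/-- Along almost every curve, even one leaving `U`, the derivative of `u` is bounded by a weak
upper gradient of `u` in `U` at almost every time spent in `U`. -/
lemma IsWeakUpperGradient.eventually_deriv_le [ProperSpace X] (hU : IsOpen U)
    (h : IsWeakUpperGradient μ U u g) (hfin : LocallyFiniteIntegral μ U g) :
    ∀ᶠ γ in curveAE μ, ∀ᵐ t ∂(volume.restrict (Icc 0 γ.len)), γ.toFun t ∈ U →
      ENNReal.ofReal |deriv (fun t => (u (γ.toFun t)).toReal) t| ≤ g (γ.toFun t) := by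
  filter_upwards [h.eventually_regular_sub hU hfin] with γ hγ
  have h1 : ∀ᵐ t : ℝ, ∀ p q : ℚ, 0 ≤ (p : ℝ) → (p : ℝ) < q → (q : ℝ) ≤ γ.len →
      (∀ r ∈ Icc (p : ℝ) q, γ.toFun r ∈ U) → t ∈ Icc (p : ℝ) q →
      ENNReal.ofReal |deriv (fun t => (u (γ.toFun t)).toReal) t| ≤ g (γ.toFun t) := by
    simp only [ae_all_iff]
    intro p q hp hpq hq hU
    exact (ae_restrict_iff' measurableSet_Icc).1 (hγ p q hp hpq hq hU).2.2
  have ha : ∀ᵐ x : ℝ, x ≠ 0 := by simp [ae_iff, measure_singleton]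
  have hb : ∀ᵐ x : ℝ, x ≠ γ.len := by simp [ae_iff, measure_singleton]
  rw [ae_restrict_iff' measurableSet_Icc]
  filter_upwards [h1, ha, hb] with t ht h0 hL htI htU
  have h0t : 0 < t := lt_of_le_of_ne htI.1 h0.symm
  have htL : t < γ.len := lt_of_le_of_ne htI.2 hL
  have hc : ContinuousAt γ.toFun t :=
    (γ.continuousOn t htI).continuousAt (Icc_mem_nhds h0t htL)
  have hnb : ∀ᶠ r in 𝓝 t, γ.toFun r ∈ U ∧ r ∈ Icc 0 γ.len :=
    (hc.eventually (hU.mem_nhds htU)).and (Icc_mem_nhds h0t htL)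
  obtain ⟨ε, hε, hball⟩ := Metric.eventually_nhds_iff.1 hnb
  obtain ⟨p, hp1, hp2⟩ := exists_rat_btwn (show t - ε < t by linarith)
  obtain ⟨q, hq1, hq2⟩ := exists_rat_btwn (show t < t + ε by linarith)
  have hin : ∀ r ∈ Icc (p : ℝ) q, γ.toFun r ∈ U ∧ r ∈ Icc 0 γ.len := fun r hr =>
    hball (by rw [Real.dist_eq, abs_lt]; constructor <;> linarith [hr.1, hr.2])
  have hpq : (p : ℝ) < q := hp2.trans hq1
  exact ht p q (hin p (left_mem_Icc.2 hpq.le)).2.1 hpq (hin q (right_mem_Icc.2 hpq.le)).2.2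
    (fun r hr => (hin r hr).1) ⟨hp2.le, hq1.le⟩

/-- A derivative bound along almost every curve gives a weak upper gradient. -/
lemma isWeakUpperGradient_of_regularAlong (hg : Measurable g)
    (h : ∀ᶠ γ in curveAE μ, γ.LiesIn U → RegularAlong u γ ∧
      ∀ᵐ t ∂(volume.restrict (Icc 0 γ.len)),
        ENNReal.ofReal |deriv (fun t => (u (γ.toFun t)).toReal) t| ≤ g (γ.toFun t)) :
    IsWeakUpperGradient μ U u g := by
  refine isWeakUpperGradient_iff.2 ⟨hg, ?_⟩
  filter_upwards [h] with γ hγ hγU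
  obtain ⟨⟨hr, hac⟩, hd⟩ := hγ hγU
  refine ⟨fun s t hs ht => ?_, fun hne => ?_⟩
  · have := le_lintegral_of_ae_deriv_le γ.len_pos.le hac hd
    rwa [hs, ht, EReal.toReal_coe, EReal.toReal_coe] at this
  · rcases hne with hne | hne
    · exact absurd (hr 0 ⟨le_rfl, γ.len_pos.le⟩) hne
    · exact absurd (hr γ.len ⟨γ.len_pos.le, le_rfl⟩) hne

open scoped Classical in
/-- Weak upper gradients `g i` in open sets `V i` may be combined to their infimum, provided that
each curve in `U` lies in one of the `V i`. -/
lemma isWeakUpperGradient_iInf [ProperSpace X] {ι : Type*} [Countable ι] {V : ι → Set X}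
    {g : ι → X → ℝ≥0∞} (hV : ∀ i, IsOpen (V i)) (hg : ∀ i, IsWeakUpperGradient μ (V i) u (g i))
    (hfin : ∀ i, LocallyFiniteIntegral μ (V i) (g i))
    (hcov : ∀ γ : Curve X, γ.LiesIn U → ∃ i, γ.LiesIn (V i)) :
    IsWeakUpperGradient μ U u (fun x => ⨅ i, (V i)ᶜ.piecewise (fun _ => ∞) (g i) x) := by
  refine isWeakUpperGradient_of_regularAlong (.iInf fun i =>
    Measurable.piecewise (hV i).measurableSet.compl measurable_const (hg i).1) ?_
  filter_upwards [eventually_countable_forall.2 fun i =>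
      (hg i).eventually_regularAlong (hV i) (hfin i),
    eventually_countable_forall.2 fun i => (hg i).eventually_deriv_le (hV i) (hfin i)]
    with γ h1 h2 hγU
  obtain ⟨i, hi⟩ := hcov γ hγU
  refine ⟨h1 i hi, ?_⟩
  filter_upwards [ae_all_iff.2 h2] with t ht
  refine le_iInf fun j => ?_
  by_cases hj : γ.toFun t ∈ V j
  · rw [piecewise_eq_of_notMem _ _ _ (notMem_compl_iff.2 hj)]
    exact ht j hj
  · rw [piecewise_eq_of_mem _ _ _ (mem_compl hj)]
    exact le_top

/-! ### Minimal weak upper gradients -/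

open scoped Classical in
lemma isWeakUpperGradient_iInf_same [ProperSpace X] (hU : IsOpen U) {ι : Type*} [Countable ι]
    [Nonempty ι] {g : ι → X → ℝ≥0∞} (hg : ∀ i, IsWeakUpperGradient μ U u (g i))
    (hfin : ∀ i, LocallyFiniteIntegral μ U (g i)) :
    ∃ G : X → ℝ≥0∞, IsWeakUpperGradient μ U u G ∧ LocallyFiniteIntegral μ U G ∧
      ∀ i, ∀ x ∈ U, G x ≤ g i x := by
  have hle : ∀ i, ∀ x ∈ U, ⨅ j, Uᶜ.piecewise (fun _ => ∞) (g j) x ≤ g i x := by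
    intro i x hx
    refine (iInf_le _ i).trans_eq ?_
    rw [piecewise_eq_of_notMem _ _ _ (notMem_compl_iff.2 hx)]
  refine ⟨_, isWeakUpperGradient_iInf (V := fun _ : ι => U) (fun _ => hU) hg hfin
    (fun γ hγ => ⟨Classical.arbitrary ι, hγ⟩), ?_, hle⟩
  refine (hfin (Classical.arbitrary ι)).mono ?_
  exact (ae_restrict_iff' hU.measurableSet).2 (ae_of_all _ fun x hx => hle _ x hx)

/-- A function with a locally integrable weak upper gradient has a minimal one: the infimum of
a countable family minimizing the integrals over all members of an exhaustion. -/
lemma exists_isMinimalWeakUpperGradient [ProperSpace X] (hU : IsOpen U)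
    (h : IsWeakUpperGradient μ U u g) (hfin : LocallyFiniteIntegral μ U g) :
    ∃ G, IsMinimalWeakUpperGradient μ U u G := by
  obtain ⟨V, hVo, hVc, hV⟩ := exists_open_exhaustion hU
  let W : Set (X → ℝ≥0∞) := {g | IsWeakUpperGradient μ U u g ∧ LocallyFiniteIntegral μ U g}
  have hW : W.Nonempty := ⟨g, h, hfin⟩
  have hseq : ∀ n, ∃ s : ℕ → X → ℝ≥0∞, (∀ k, s k ∈ W) ∧
      Tendsto (fun k => ∫⁻ x in V n, s k x ∂μ) atTop
        (𝓝 (sInf ((fun g : X → ℝ≥0∞ => ∫⁻ x in V n, g x ∂μ) '' W))) := by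
    intro n
    obtain ⟨y, -, hy, hyW⟩ := exists_seq_tendsto_sInf
      (S := (fun g : X → ℝ≥0∞ => ∫⁻ x in V n, g x ∂μ) '' W) (hW.image _) (OrderBot.bddBelow _)
    choose s hs hsy using hyW
    exact ⟨s, hs, by simpa only [hsy] using hy⟩
  choose s hs hlim using hseq
  obtain ⟨G, hG, hGfin, hGle⟩ := isWeakUpperGradient_iInf_same hU (ι := ℕ × ℕ)
    (g := fun i => s i.1 i.2) (fun i => (hs i.1 i.2).1) (fun i => (hs i.1 i.2).2)
  refine ⟨G, hG, hGfin, fun g' hg' hfin' => ?_⟩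
  obtain ⟨F, hF, hFfin, hFle⟩ := isWeakUpperGradient_iInf_same hU (ι := Bool)
    (g := fun b => if b then G else g') (by rintro (_ | _) <;> simpa)
    (by rintro (_ | _) <;> simpa)
  have hsubU : ∀ n, V n ⊆ U := fun n => subset_closure.trans (hVc n).2
  have hn : ∀ n, ∀ᵐ x ∂μ.restrict (V n), G x ≤ g' x := by
    intro n
    have h1 : ∫⁻ x in V n, G x ∂μ ≤ ∫⁻ x in V n, F x ∂μ := by
      have hle : ∀ k, ∫⁻ x in V n, G x ∂μ ≤ ∫⁻ x in V n, s n k x ∂μ := fun k =>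
        setLIntegral_mono' (hVo n).measurableSet fun x hx => hGle (n, k) x (hsubU n hx)
      exact (ge_of_tendsto' (hlim n) hle).trans (sInf_le ⟨F, ⟨hF, hFfin⟩, rfl⟩)
    have h2 : ∀ᵐ x ∂μ.restrict (V n), F x ≤ G x :=
      (ae_restrict_iff' (hVo n).measurableSet).2
        (ae_of_all _ fun x hx => by simpa using hFle true x (hsubU n hx))
    have h3 := ae_eq_of_ae_le_of_lintegral_le h2 (hFfin _ (hVo n) (hVc n)).ne
      hG.1.aemeasurable h1
    filter_upwards [h3, ae_restrict_mem (hVo n).measurableSet] with x hx hxV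
    rw [← hx]
    simpa using hFle false x (hsubU n hxV)
  have hUV : U ⊆ ⋃ n, V n := by
    intro x hx
    obtain ⟨n, hn⟩ := hV {x} isCompact_singleton (singleton_subset_iff.2 hx)
    exact mem_iUnion.2 ⟨n, hn rfl⟩
  exact ae_restrict_of_ae_restrict_of_subset hUV (ae_restrict_iUnion_iff _ _ |>.2 hn)

lemma isMinimalWeakUpperGradient_minGrad [ProperSpace X] (hU : IsOpen U)
    (h : IsWeakUpperGradient μ U u g) (hfin : LocallyFiniteIntegral μ U g) :
    IsMinimalWeakUpperGradient μ U u (minGrad μ U u) := by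
  have hex := exists_isMinimalWeakUpperGradient hU h hfin
  rw [minGrad, dif_pos hex]
  exact hex.choose_spec

lemma minGrad_le [ProperSpace X] (hU : IsOpen U)
    (h : IsWeakUpperGradient μ U u g) (hfin : LocallyFiniteIntegral μ U g) :
    ∀ᵐ x ∂μ.restrict U, minGrad μ U u x ≤ g x :=
  (isMinimalWeakUpperGradient_minGrad hU h hfin).2.2 g h hfin

lemma IsUpperGradient.isWeakUpperGradient (h : IsUpperGradient U u g) :
    IsWeakUpperGradient μ U u g :=
  isWeakUpperGradient_iff.2 ⟨h.1, Eventually.of_forall h.2⟩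

/-- The minimal weak upper gradient of a function of `N^{1,1}_loc(U)` exists. -/
lemma MemNewtonianLoc.isMinimalWeakUpperGradient [ProperSpace X] (hU : IsOpen U)
    (hu : MemNewtonianLoc μ U u) : IsMinimalWeakUpperGradient μ U u (minGrad μ U u) := by
  obtain ⟨V, hVo, hVc, hV⟩ := exists_open_exhaustion hU
  classical
  choose g hg hgfin using fun n => (hu (V n) (hVo n) (hVc n)).2.2
  refine isMinimalWeakUpperGradient_minGrad hU (isWeakUpperGradient_iInf hVo
    (fun n => (hg n).isWeakUpperGradient)
    (fun n => .of_lintegral_lt_top (hgfin n)) fun γ hγ => ?_) ?_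
  · obtain ⟨n, hn⟩ := hV _ γ.isCompact_image (image_subset_iff.2 hγ)
    exact ⟨n, image_subset_iff.1 hn⟩
  · intro W hWo hW
    obtain ⟨n, hn⟩ := hV _ hW.1 hW.2
    have hWV : W ⊆ V n := subset_closure.trans hn
    refine lt_of_le_of_lt (setLIntegral_mono' hWo.measurableSet fun x hx => ?_)
      ((lintegral_mono_set hWV).trans_lt (hgfin n))
    refine (iInf_le _ n).trans_eq ?_
    rw [piecewise_eq_of_notMem _ _ _ (notMem_compl_iff.2 (hWV hx))]

/-- An integrable weak upper gradient suffices for membership in `N^{1,1}`: adding a function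
with infinite integral along all exceptional curves makes it an upper gradient. -/
lemma memNewtonian_of_isWeakUpperGradient (hu : AEMeasurable u (μ.restrict U))
    (hu1 : ∫⁻ x in U, (u x).abs ∂μ < ∞) (hg : IsWeakUpperGradient μ U u g)
    (hfin : ∫⁻ x in U, g x ∂μ < ∞) : MemNewtonian μ U u := by
  obtain ⟨hgm, hg⟩ := isWeakUpperGradient_iff.1 hg
  obtain ⟨r, hr, hrfin, htop⟩ := eventually_curveAE.1 hg
  refine ⟨hu, hu1, fun x => g x + r x, ⟨hgm.add hr, fun γ hγ => ?_⟩, ?_⟩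
  · by_cases hγg : UpperGradientIneq u g γ
    · exact hγg.mono fun x => le_self_add
    · refine upperGradientIneq_of_integral_eq_top (top_le_iff.1 ?_)
      rw [← htop γ fun h => hγg (h hγ)]
      exact γ.integral_mono fun x => le_add_self
  · rw [lintegral_add_left hgm]
    exact ENNReal.add_lt_top.2 ⟨hfin, (setLIntegral_le_lintegral _ _).trans_lt hrfin⟩

/-! ### Locality of weak upper gradients -/

/-- Being a weak upper gradient is local: it may be checked on two open sets covering `X`. -/
lemma IsWeakUpperGradient.of_union_eq_univ {V₁ V₂ : Set X} (hV₁ : IsOpen V₁) (hV₂ : IsOpen V₂)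
    (hV : V₁ ∪ V₂ = univ) (h₁ : IsWeakUpperGradient μ V₁ u g)
    (h₂ : IsWeakUpperGradient μ V₂ u g) : IsWeakUpperGradient μ univ u g := by
  refine isWeakUpperGradient_iff.2 ⟨h₁.1, ?_⟩
  filter_upwards [eventually_curveAE_sub (isWeakUpperGradient_iff.1 h₁).2,
    eventually_curveAE_sub (isWeakUpperGradient_iff.1 h₂).2] with γ hγ₁ hγ₂ _
  by_cases hfin : γ.integral g = ∞
  · exact upperGradientIneq_of_integral_eq_top hfin
  -- by Lebesgue's number lemma, short sub-curves stay in one of the two sets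
  obtain ⟨δ, hδ, hleb⟩ : ∃ δ > 0, ∀ s t, 0 ≤ s → s < t → t ≤ γ.len → t - s < δ →
      (∀ r ∈ Icc s t, γ.toFun r ∈ V₁) ∨ (∀ r ∈ Icc s t, γ.toFun r ∈ V₂) := by
    have hc : Continuous ((Icc 0 γ.len).domRestrict γ.toFun) :=
      continuousOn_iff_continuous_domRestrict.1 γ.continuousOn
    obtain ⟨δ, hδ, hball⟩ := lebesgue_number_lemma_of_metric (s := (univ : Set (Icc 0 γ.len)))
      (c := fun b : Bool => (Icc 0 γ.len).domRestrict γ.toFun ⁻¹' (if b then V₁ else V₂))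
      isCompact_univ (by rintro (_ | _) <;> simpa using (by assumption : IsOpen _).preimage hc)
      (by
        intro x _
        have : γ.toFun x ∈ V₁ ∪ V₂ := hV ▸ mem_univ _
        simpa [or_comm, Set.domRestrict] using this)
    refine ⟨δ, hδ, fun s t hs hst ht hts => ?_⟩
    obtain ⟨b, hb⟩ := hball ⟨s, hs, hst.le.trans ht⟩ (mem_univ _)
    have key : ∀ r ∈ Icc s t, γ.toFun r ∈ (if b then V₁ else V₂) := by
      intro r hr
      refine hb (a := ⟨r, hs.trans hr.1, hr.2.trans ht⟩) ?_
      rw [Metric.mem_ball, Subtype.dist_eq, Real.dist_eq, abs_of_nonneg (by simpa using hr.1)]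
      have := hr.2
      simp only
      linarith
    cases b
    · exact Or.inr (by simpa using key)
    · exact Or.inl (by simpa using key)
  have hshort : ∀ s t (hs : 0 ≤ s) (hst : s < t) (ht : t ≤ γ.len), t - s < δ →
      UpperGradientIneq u g (γ.sub s t hs hst ht) := by
    intro s t hs hst ht hts
    rcases hleb s t hs hst ht hts with h | h
    · exact hγ₁ s t hs hst ht ((Curve.liesIn_sub _ _ _).2 h)
    · exact hγ₂ s t hs hst ht ((Curve.liesIn_sub _ _ _).2 h)
  have hsubfin : ∀ s t (hs : 0 ≤ s) (hst : s < t) (ht : t ≤ γ.len),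
      (γ.sub s t hs hst ht).integral g ≠ ∞ := fun s t hs hst ht =>
    ne_top_of_le_ne_top hfin (γ.integral_sub_le hs hst ht g)
  have hreal : ∀ t ∈ Icc 0 γ.len, ∃ r : ℝ, u (γ.toFun t) = r := by
    intro t ht
    by_contra hne
    rcases ht.2.eq_or_lt with rfl | htL
    · have hs : 0 ≤ max 0 (γ.len - δ / 2) := le_max_left _ _
      have hst : max 0 (γ.len - δ / 2) < γ.len := max_lt γ.len_pos (by linarith)
      refine hsubfin _ _ hs hst le_rfl ((hshort _ _ hs hst le_rfl ?_).2 (Or.inr ?_))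
      · have := le_max_right 0 (γ.len - δ / 2)
        linarith
      · simpa [Curve.sub] using hne
    · have hst : t < min γ.len (t + δ / 2) := lt_min htL (by linarith)
      refine hsubfin _ _ ht.1 hst (min_le_left _ _)
        ((hshort _ _ ht.1 hst (min_le_left _ _) ?_).2 (Or.inl ?_))
      · have := min_le_right γ.len (t + δ / 2)
        linarith
      · simpa [Curve.sub] using hne
  choose! f hf using hreal
  have hstep : ∀ n : ℕ, ∀ s t, 0 ≤ s → s < t → t ≤ γ.len → t - s ≤ n * (δ / 2) →
      ENNReal.ofReal |f s - f t| ≤ ∫⁻ r in Icc s t, g (γ.toFun r) := by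
    intro n
    induction n with
    | zero => intro s t _ hst _ h; simp at h; linarith
    | succ n ih =>
      intro s t hs hst ht hn
      have hone : ∀ s t, 0 ≤ s → s < t → t ≤ γ.len → t - s < δ →
          ENNReal.ofReal |f s - f t| ≤ ∫⁻ r in Icc s t, g (γ.toFun r) := by
        intro s t hs hst ht hts
        rw [← γ.integral_sub hs hst ht]
        refine (hshort s t hs hst ht hts).1 _ _ ?_ ?_
        · simpa [Curve.sub] using hf s ⟨hs, hst.le.trans ht⟩
        · simpa [Curve.sub] using hf t ⟨hs.trans hst.le, ht⟩
      by_cases hts : t - s < δ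
      · exact hone s t hs hst ht hts
      · have hsm : s < s + δ / 2 := by linarith
        have hmt : s + δ / 2 < t := by linarith
        have e1 := hone s (s + δ / 2) hs hsm (by linarith) (by linarith)
        have e2 := ih (s + δ / 2) t (by linarith) hmt ht (by push_cast at hn; linarith)
        calc ENNReal.ofReal |f s - f t|
            ≤ ENNReal.ofReal (|f s - f (s + δ / 2)| + |f (s + δ / 2) - f t|) :=
              ENNReal.ofReal_le_ofReal (abs_sub_le _ _ _)
          _ = _ := ENNReal.ofReal_add (abs_nonneg _) (abs_nonneg _)
          _ ≤ _ := add_le_add e1 e2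
          _ = _ := by
              simp only [← setLIntegral_congr (f := fun r => g (γ.toFun r))
                (Ioc_ae_eq_Icc (α := ℝ) (μ := volume))]
              rw [← Ioc_union_Ioc_eq_Ioc hsm.le hmt.le,
                lintegral_union measurableSet_Ioc (Ioc_disjoint_Ioc_of_le le_rfl)]
  obtain ⟨n, hn⟩ := exists_nat_ge (γ.len / (δ / 2))
  rw [div_le_iff₀ (by positivity)] at hn
  have h0 := hf 0 ⟨le_rfl, γ.len_pos.le⟩
  have hL := hf γ.len ⟨γ.len_pos.le, le_rfl⟩
  refine ⟨fun s t hs ht => ?_, ?_⟩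
  · rw [h0, EReal.coe_eq_coe_iff] at hs
    rw [hL, EReal.coe_eq_coe_iff] at ht
    rw [← hs, ← ht]
    exact hstep n 0 γ.len le_rfl γ.len_pos le_rfl (by simpa using hn)
  · rintro (h | h)
    · exact absurd ⟨_, h0⟩ h
    · exact absurd ⟨_, hL⟩ h

end

section

/-! ### Derivatives of truncations and cut-offs -/

section Deriv

variable {F E : ℝ → ℝ} {t k L : ℝ}

lemma abs_deriv_max_sub_le (hF : DifferentiableAt ℝ F t) :
    |deriv (fun r => max (F r - k) 0) t| ≤ if k < F t then |deriv F t| else 0 := by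
  split_ifs with hk
  · have : (fun r => max (F r - k) 0) =ᶠ[𝓝 t] fun r => F r - k := by
      filter_upwards [hF.continuousAt.eventually (lt_mem_nhds hk)] with r hr
      exact max_eq_left (sub_nonneg.2 (le_of_lt hr))
    rw [this.deriv_eq, deriv_sub_const]
  · have : IsLocalMin (fun r => max (F r - k) 0) t := by
      refine Eventually.of_forall fun r => ?_
      simp only [max_eq_right (sub_nonpos.2 (not_lt.1 hk))]
      exact le_max_right _ _
    rw [this.deriv_eq_zero, abs_zero]

lemma abs_deriv_mul_max_sub_le (hF : DifferentiableAt ℝ F t) (hE : DifferentiableAt ℝ E t)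
    (hE0 : ∀ r, 0 ≤ E r) (hL : |deriv E t| ≤ L) :
    |deriv (fun r => E r * max (F r - k) 0) t| ≤
      if k < F t then E t * |deriv F t| + (F t - k) * L else 0 := by
  split_ifs with hk
  · have : (fun r => E r * max (F r - k) 0) =ᶠ[𝓝 t] fun r => E r * (F r - k) := by
      filter_upwards [hF.continuousAt.eventually (lt_mem_nhds hk)] with r hr
      rw [max_eq_left (sub_nonneg.2 (le_of_lt hr))]
    rw [this.deriv_eq, (hE.hasDerivAt.fun_mul (hF.hasDerivAt.sub_const k)).deriv, add_comm]
    refine (abs_add_le _ _).trans (add_le_add ?_ ?_)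
    · rw [abs_mul, abs_of_nonneg (hE0 t)]
    · rw [abs_mul, abs_of_pos (sub_pos.2 hk), mul_comm]
      exact mul_le_mul_of_nonneg_left hL (sub_pos.2 hk).le
  · have : IsLocalMin (fun r => E r * max (F r - k) 0) t := by
      refine Eventually.of_forall fun r => ?_
      simp only [max_eq_right (sub_nonpos.2 (not_lt.1 hk)), mul_zero]
      exact mul_nonneg (hE0 r) (le_max_right _ _)
    rw [this.deriv_eq_zero, abs_zero]

lemma abs_deriv_sub_mul_max_sub_le (hF : DifferentiableAt ℝ F t) (hE : DifferentiableAt ℝ E t)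
    (hE0 : ∀ r, 0 ≤ E r) (hE1 : ∀ r, E r ≤ 1) (hL : |deriv E t| ≤ L)
    (hw : DifferentiableAt ℝ (fun r => E r * max (F r - k) 0) t) :
    |deriv (fun r => F r - E r * max (F r - k) 0) t| ≤
      if k < F t then (1 - E t) * |deriv F t| + (F t - k) * L else |deriv F t| := by
  split_ifs with hk
  · have : (fun r => F r - E r * max (F r - k) 0) =ᶠ[𝓝 t] fun r => F r - E r * (F r - k) := by
      filter_upwards [hF.continuousAt.eventually (lt_mem_nhds hk)] with r hr
      rw [max_eq_left (sub_nonneg.2 (le_of_lt hr))]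
    rw [this.deriv_eq,
      (hF.hasDerivAt.fun_sub (hE.hasDerivAt.fun_mul (hF.hasDerivAt.sub_const k))).deriv]
    have : deriv F t - (deriv E t * (F t - k) + E t * deriv F t) =
        (1 - E t) * deriv F t - (F t - k) * deriv E t := by ring
    rw [this]
    refine (abs_sub _ _).trans (add_le_add ?_ ?_)
    · rw [abs_mul, abs_of_nonneg (sub_nonneg.2 (hE1 t))]
    · rw [abs_mul, abs_of_pos (sub_pos.2 hk)]
      exact mul_le_mul_of_nonneg_left hL (sub_pos.2 hk).le
  · have h0 : |deriv (fun r => E r * max (F r - k) 0) t| ≤ 0 := by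
      simpa [hk] using abs_deriv_mul_max_sub_le (k := k) hF hE hE0 hL
    rw [deriv_fun_sub hF hw, abs_nonpos_iff.1 h0, sub_zero]

lemma abs_deriv_le_of_lipschitzOn_Icc {a b : ℝ} (hL : 0 ≤ L) (ht : t ∈ Ioo a b)
    (hE : ∀ r ∈ Icc a b, ∀ r' ∈ Icc a b, |E r - E r'| ≤ L * |r - r'|) : |deriv E t| ≤ L := by
  have := norm_deriv_le_of_lip' (f := E) (x₀ := t) hL (by
    filter_upwards [Icc_mem_nhds ht.1 ht.2] with r hr
    exact hE r hr t (Ioo_subset_Icc_self ht))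
  simpa using this

end Deriv

variable {X : Type*} [MetricSpace X]

/-! ### Cut-off functions and the competitor -/

/-- The Lipschitz cut-off function which is `1` on the ball of radius `s` about `x₀`, vanishes
outside the ball of radius `t`, and is affine in the distance to `x₀` in between. -/
def cutoff (x₀ : X) (s t : ℝ) (x : X) : ℝ := max 0 (min 1 ((t - dist x x₀) / (t - s)))

section Cutoff

variable {x₀ x : X} {s t : ℝ}

lemma cutoff_nonneg : 0 ≤ cutoff x₀ s t x := le_max_left _ _

lemma cutoff_le_one : cutoff x₀ s t x ≤ 1 := max_le zero_le_one (min_le_left _ _)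

lemma cutoff_eq_one (hst : s < t) (hx : dist x x₀ ≤ s) : cutoff x₀ s t x = 1 := by
  have : 1 ≤ (t - dist x x₀) / (t - s) := by rw [le_div_iff₀ (sub_pos.2 hst)]; linarith
  rw [cutoff, min_eq_left this, max_eq_right zero_le_one]

lemma cutoff_eq_zero (hst : s < t) (hx : t ≤ dist x x₀) : cutoff x₀ s t x = 0 := by
  have : (t - dist x x₀) / (t - s) ≤ 0 :=
    div_nonpos_of_nonpos_of_nonneg (by linarith) (sub_pos.2 hst).le
  rw [cutoff, max_eq_left ((min_le_right _ _).trans this)]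

lemma continuous_cutoff : Continuous (cutoff x₀ s t) := by
  unfold cutoff
  fun_prop

lemma abs_cutoff_sub_le (hst : s < t) (y : X) :
    |cutoff x₀ s t x - cutoff x₀ s t y| ≤ (t - s)⁻¹ * dist x y := by
  have h1 : |cutoff x₀ s t x - cutoff x₀ s t y| ≤
      |(t - dist x x₀) / (t - s) - (t - dist y x₀) / (t - s)| := by
    refine (abs_max_sub_max_le_max _ _ _ _).trans (max_le (by simp) ?_)
    exact (abs_min_sub_min_le_max _ _ _ _).trans (max_le (by simp) le_rfl)
  refine h1.trans ?_
  rw [← sub_div, abs_div, abs_of_pos (sub_pos.2 hst), div_eq_inv_mul]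
  refine mul_le_mul_of_nonneg_left ?_ (inv_pos.2 (sub_pos.2 hst)).le
  rw [sub_sub_sub_cancel_left, abs_sub_comm]
  exact abs_dist_sub_le x y x₀

end Cutoff

lemma truncPos_coe {α : Type*} (u : α → EReal) (k r : ℝ) (x : α) (h : u x = r) :
    truncPos u k x = ((max (r - k) 0 : ℝ) : EReal) := by
  rw [truncPos, h, ← EReal.coe_sub]
  exact (EReal.coe_strictMono.monotone.map_max (a := r - k) (b := 0)).symm

lemma RegularAlong.truncation {u : X → EReal} {γ : Curve X} (h : RegularAlong u γ) (k : ℝ) :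
    AbsolutelyContinuousOnInterval (fun t => max ((u (γ.toFun t)).toReal - k) 0) 0 γ.len := by
  refine absolutelyContinuousOnInterval_of_dist_le h.2 fun s _ t _ => ?_
  rw [Real.dist_eq, Real.dist_eq]
  refine (abs_max_sub_max_le_max _ _ _ _).trans (max_le ?_ (by simp))
  rw [sub_sub_sub_cancel_right]

section TestFunction

variable (u : X → EReal) (x₀ : X) (s t k : ℝ)

/-- The product of the cut-off function and the truncation `(u - k)_+`. -/
def cutTrunc (x : X) : ℝ := cutoff x₀ s t x * max ((u x).toReal - k) 0

/-- The competitor `u - η (u - k)_+`, where `η` is a cut-off function. Infinite values of `u` are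
replaced by zero beforehand, which matters only on a null set missed by almost every curve. -/
def competitor (x : X) : ℝ := (u x).toReal - cutTrunc u x₀ s t k x

variable {u x₀ s t k}

lemma cutTrunc_nonneg {x : X} : 0 ≤ cutTrunc u x₀ s t k x :=
  mul_nonneg cutoff_nonneg (le_max_right _ _)

lemma cutTrunc_eq_zero {x : X} (hst : s < t) (hx : t ≤ dist x x₀) : cutTrunc u x₀ s t k x = 0 := by
  rw [cutTrunc, cutoff_eq_zero hst hx, zero_mul]

lemma abs_cutoff_comp_sub_le (hst : s < t) (γ : Curve X) :
    ∀ r ∈ Icc 0 γ.len, ∀ r' ∈ Icc 0 γ.len,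
      |cutoff x₀ s t (γ.toFun r) - cutoff x₀ s t (γ.toFun r')| ≤ (t - s)⁻¹ * |r - r'| := by
  intro r hr r' hr'
  refine (abs_cutoff_sub_le hst _).trans ?_
  refine mul_le_mul_of_nonneg_left ?_ (inv_pos.2 (sub_pos.2 hst)).le
  simpa [Real.dist_eq] using γ.lipschitzOnWith.dist_le_mul r hr r' hr'

lemma absolutelyContinuous_cutoff_comp (hst : s < t) (γ : Curve X) :
    AbsolutelyContinuousOnInterval (fun r => cutoff x₀ s t (γ.toFun r)) 0 γ.len := by
  have hL : 0 ≤ (t - s)⁻¹ := (inv_pos.2 (sub_pos.2 hst)).le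
  refine LipschitzOnWith.absolutelyContinuousOnInterval (K := ⟨(t - s)⁻¹, hL⟩) ?_
  rw [uIcc_of_le γ.len_pos.le]
  refine LipschitzOnWith.of_dist_le_mul fun r hr r' hr' => ?_
  rw [Real.dist_eq, Real.dist_eq]
  exact abs_cutoff_comp_sub_le hst γ r hr r' hr'

end TestFunction

variable [MeasurableSpace X] [BorelSpace X] {μ : Measure X} {U : Set X} {u : X → EReal}
  {g : X → ℝ≥0∞} {x₀ : X} {s t k : ℝ}

/-! ### Truncation and Leibniz rules for weak upper gradients -/

lemma isWeakUpperGradient_coe {f : X → ℝ} (hg : Measurable g)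
    (h : ∀ᶠ γ in curveAE μ, γ.LiesIn U →
      AbsolutelyContinuousOnInterval (fun t => f (γ.toFun t)) 0 γ.len ∧
      ∀ᵐ t ∂(volume.restrict (Icc 0 γ.len)),
        ENNReal.ofReal |deriv (fun t => f (γ.toFun t)) t| ≤ g (γ.toFun t)) :
    IsWeakUpperGradient μ U (fun x => (f x : EReal)) g := by
  refine isWeakUpperGradient_of_regularAlong hg ?_
  filter_upwards [h] with γ hγ hγU
  refine ⟨⟨fun t _ => ⟨_, rfl⟩, ?_⟩, ?_⟩
  · simpa only [EReal.toReal_coe] using (hγ hγU).1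
  · simpa only [EReal.toReal_coe] using (hγ hγU).2

lemma IsWeakUpperGradient.congr_gradient {g' : X → ℝ≥0∞} (h : IsWeakUpperGradient μ U u g)
    (hg' : Measurable g') (hgg' : ∀ x ∈ U, g x = g' x) : IsWeakUpperGradient μ U u g' := by
  refine isWeakUpperGradient_iff.2 ⟨hg', ?_⟩
  filter_upwards [(isWeakUpperGradient_iff.1 h).2] with γ hγ hγU
  have : γ.integral g = γ.integral g' :=
    setLIntegral_congr_fun measurableSet_Icc fun t ht => hgg' _ (hγU t ht)
  have hγ := hγ hγU
  rwa [UpperGradientIneq, this] at hγ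

/-- What is needed about `u` along almost every curve, including a measurable representative `f`
of its real part. -/
lemma IsWeakUpperGradient.eventually_representative [ProperSpace X] (hU : IsOpen U)
    (h : IsWeakUpperGradient μ U u g) (hfin : LocallyFiniteIntegral μ U g) {f : X → ℝ}
    (hf : ∀ᵐ x ∂μ.restrict U, (u x).toReal = f x) :
    ∀ᶠ γ in curveAE μ, γ.LiesIn U → RegularAlong u γ ∧
      ∀ᵐ t ∂(volume.restrict (Icc 0 γ.len)), t ∈ Ioo 0 γ.len ∧
        DifferentiableAt ℝ (fun t => (u (γ.toFun t)).toReal) t ∧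
        ENNReal.ofReal |deriv (fun t => (u (γ.toFun t)).toReal) t| ≤ g (γ.toFun t) ∧
        (u (γ.toFun t)).toReal = f (γ.toFun t) := by
  filter_upwards [h.eventually_regularAlong hU hfin, h.eventually_deriv_le hU hfin,
    eventually_curveAE_of_ae_restrict hU.measurableSet hf] with γ h1 h2 h3 hγU
  have hreg := h1 hγU
  refine ⟨hreg, ?_⟩
  have hd := hreg.2.ae_differentiableAt
  rw [uIcc_of_le γ.len_pos.le] at hd
  have ha : ∀ᵐ x : ℝ, x ≠ 0 := by simp [ae_iff, measure_singleton]
  have hb : ∀ᵐ x : ℝ, x ≠ γ.len := by simp [ae_iff, measure_singleton]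
  filter_upwards [h2, h3, (ae_restrict_iff' measurableSet_Icc).2 hd, ae_restrict_of_ae ha,
    ae_restrict_of_ae hb, ae_restrict_mem measurableSet_Icc] with t e2 e3 e4 e5 e6 e7
  exact ⟨⟨lt_of_le_of_ne e7.1 e5.symm, lt_of_le_of_ne e7.2 e6⟩, e4, e2 (hγU t e7), e3 (hγU t e7)⟩

/-- The truncation `(u - k)_+` has a weak upper gradient equal to that of `u` on `{u > k}` and to
zero elsewhere. -/
lemma IsWeakUpperGradient.truncPos [ProperSpace X] (hU : IsOpen U)
    (h : IsWeakUpperGradient μ U u g) (hfin : LocallyFiniteIntegral μ U g)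
    (hu : AEMeasurable u (μ.restrict U)) (k : ℝ) :
    ∃ g', IsWeakUpperGradient μ U (truncPos u k) g' ∧
      ∀ᵐ x ∂μ.restrict U, g' x = if k < (u x).toReal then g x else 0 := by
  -- `u` is only almost everywhere measurable, so a Borel representative `f` of its real part
  -- defines the gradient; almost every curve spends no time where the two differ
  have hu' := hu.ereal_toReal
  have hf := hu'.measurable_mk
  set f := hu'.mk with hfdef
  have hgm : Measurable fun x => if k < f x then g x else 0 :=
    Measurable.ite (measurableSet_lt measurable_const hf) h.1 measurable_const
  refine ⟨fun x => if k < f x then g x else 0, ?_, ?_⟩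
  · have hev := h.eventually_representative hU hfin hu'.ae_eq_mk
    have hw : IsWeakUpperGradient μ U (fun x => ((max ((u x).toReal - k) 0 : ℝ) : EReal))
        (fun x => if k < f x then g x else 0) := by
      refine isWeakUpperGradient_coe hgm ?_
      filter_upwards [hev] with γ hγ hγU
      obtain ⟨hreg, hae⟩ := hγ hγU
      refine ⟨hreg.truncation k, ?_⟩
      filter_upwards [hae] with t ⟨_, hd, hle, heq⟩
      refine (ENNReal.ofReal_le_ofReal (abs_deriv_max_sub_le (k := k) hd)).trans ?_
      simp only [heq]
      split_ifs
      · exact hle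
      · simp
    refine isWeakUpperGradient_iff.2 ⟨hgm, ?_⟩
    filter_upwards [hev, (isWeakUpperGradient_iff.1 hw).2] with γ h1 h2 hγU
    obtain ⟨r, hr⟩ := (h1 hγU).1.1 0 ⟨le_rfl, γ.len_pos.le⟩
    obtain ⟨r', hr'⟩ := (h1 hγU).1.1 γ.len ⟨γ.len_pos.le, le_rfl⟩
    have := h2 hγU
    simp only [UpperGradientIneq, hr, hr', EReal.toReal_coe] at this
    simpa only [UpperGradientIneq, truncPos_coe u k r _ hr, truncPos_coe u k r' _ hr'] using this
  · filter_upwards [hu'.ae_eq_mk] with x hx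
    rw [hx]

/-- The Leibniz rule along almost every curve, for `η (u - k)_+` and `u - η (u - k)_+`. -/
lemma IsWeakUpperGradient.eventually_cutTrunc [ProperSpace X] (hU : IsOpen U)
    (h : IsWeakUpperGradient μ U u g) (hfin : LocallyFiniteIntegral μ U g) {f : X → ℝ}
    (hf : ∀ᵐ x ∂μ.restrict U, (u x).toReal = f x) (hst : s < t) :
    ∀ᶠ γ in curveAE μ, γ.LiesIn U →
      (AbsolutelyContinuousOnInterval (fun r => cutTrunc u x₀ s t k (γ.toFun r)) 0 γ.len ∧
      ∀ᵐ r ∂(volume.restrict (Icc 0 γ.len)),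
        ENNReal.ofReal |deriv (fun r => cutTrunc u x₀ s t k (γ.toFun r)) r| ≤
        if k < f (γ.toFun r) then
          ENNReal.ofReal (cutoff x₀ s t (γ.toFun r)) * g (γ.toFun r) +
            ENNReal.ofReal (f (γ.toFun r) - k) * ENNReal.ofReal (t - s)⁻¹
        else 0) ∧
      (AbsolutelyContinuousOnInterval (fun r => competitor u x₀ s t k (γ.toFun r)) 0 γ.len ∧
      ∀ᵐ r ∂(volume.restrict (Icc 0 γ.len)),
        ENNReal.ofReal |deriv (fun r => competitor u x₀ s t k (γ.toFun r)) r| ≤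
        if k < f (γ.toFun r) then
          ENNReal.ofReal (1 - cutoff x₀ s t (γ.toFun r)) * g (γ.toFun r) +
            ENNReal.ofReal (f (γ.toFun r) - k) * ENNReal.ofReal (t - s)⁻¹
        else g (γ.toFun r)) := by
  have hL : 0 ≤ (t - s)⁻¹ := (inv_pos.2 (sub_pos.2 hst)).le
  filter_upwards [h.eventually_representative hU hfin hf] with γ hγ hγU
  obtain ⟨hreg, hae⟩ := hγ hγU
  have hEac := absolutelyContinuous_cutoff_comp (x₀ := x₀) hst γ
  have hwac := hEac.mul (hreg.truncation k)
  have hE : ∀ᵐ r ∂(volume.restrict (Icc 0 γ.len)),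
      DifferentiableAt ℝ (fun r => cutoff x₀ s t (γ.toFun r)) r := by
    have := hEac.ae_differentiableAt
    rw [uIcc_of_le γ.len_pos.le] at this
    exact (ae_restrict_iff' measurableSet_Icc).2 this
  have hw : ∀ᵐ r ∂(volume.restrict (Icc 0 γ.len)), DifferentiableAt ℝ
      (fun r => cutoff x₀ s t (γ.toFun r) * max ((u (γ.toFun r)).toReal - k) 0) r := by
    have := hwac.ae_differentiableAt
    rw [uIcc_of_le γ.len_pos.le] at this
    exact (ae_restrict_iff' measurableSet_Icc).2 this
  refine ⟨⟨hwac, ?_⟩, hreg.2.sub hwac, ?_⟩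
  · filter_upwards [hae, hE] with r ⟨hr, hd, hle, heq⟩ hEd
    have hl := abs_deriv_le_of_lipschitzOn_Icc hL hr (abs_cutoff_comp_sub_le (x₀ := x₀) hst γ)
    refine (ENNReal.ofReal_le_ofReal (abs_deriv_mul_max_sub_le (k := k) hd hEd
      (fun _ => cutoff_nonneg) hl)).trans ?_
    simp only [heq]
    split_ifs with hk
    · refine (ENNReal.ofReal_add_le).trans ?_
      rw [ENNReal.ofReal_mul cutoff_nonneg, ENNReal.ofReal_mul (sub_pos.2 hk).le]
      gcongr
    · simp
  · filter_upwards [hae, hE, hw] with r ⟨hr, hd, hle, heq⟩ hEd hwd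
    have hl := abs_deriv_le_of_lipschitzOn_Icc hL hr (abs_cutoff_comp_sub_le (x₀ := x₀) hst γ)
    refine (ENNReal.ofReal_le_ofReal (abs_deriv_sub_mul_max_sub_le (k := k) hd hEd
      (fun _ => cutoff_nonneg) (fun _ => cutoff_le_one) hl hwd)).trans ?_
    simp only [heq]
    split_ifs with hk
    · refine (ENNReal.ofReal_add_le).trans ?_
      rw [ENNReal.ofReal_mul (sub_nonneg.2 cutoff_le_one), ENNReal.ofReal_mul (sub_pos.2 hk).le]
      gcongr
    · exact hle

end

section

variable {X : Type*} [MeasurableSpace X]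

/-! ### Admissibility of the competitor -/

lemma measurable_ereal_abs : Measurable EReal.abs :=
  EReal.measurable_of_measurable_real (by
    simp only [EReal.abs_def]; fun_prop)

lemma ae_eq_coe_toReal {m : Measure X} {u : X → EReal} (hu : AEMeasurable u m)
    (hu1 : ∫⁻ x, (u x).abs ∂m < ∞) : ∀ᵐ x ∂m, u x = (u x).toReal := by
  filter_upwards [ae_lt_top' (measurable_ereal_abs.comp_aemeasurable hu) hu1.ne] with x hx
  refine (EReal.coe_toReal ?_ ?_).symm <;> · intro h; simp [h] at hx

lemma ofReal_abs_toReal_le_abs (z : EReal) : ENNReal.ofReal |z.toReal| ≤ z.abs := by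
  induction z <;> simp [EReal.abs_def]

lemma ofReal_max_sub_le (z : EReal) (k : ℝ) :
    ENNReal.ofReal (max (z.toReal - k) 0) ≤ z.abs + ENNReal.ofReal |k| := by
  refine le_trans ?_ (add_le_add_left (ofReal_abs_toReal_le_abs z) _)
  rw [← ENNReal.ofReal_add (abs_nonneg _) (abs_nonneg _)]
  refine ENNReal.ofReal_le_ofReal (max_le ?_ (by positivity))
  linarith [le_abs_self z.toReal, neg_abs_le k]

variable {μ : Measure X} {u : X → EReal} {g : X → ℝ≥0∞} {k : ℝ}

lemma lintegral_ofReal_max_sub_lt_top {U : Set X} (hU : μ U < ∞)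
    (hu1 : ∫⁻ x in U, (u x).abs ∂μ < ∞) (k : ℝ) :
    ∫⁻ x in U, ENNReal.ofReal (max ((u x).toReal - k) 0) ∂μ < ∞ := by
  refine (lintegral_mono fun x => ofReal_max_sub_le (u x) k).trans_lt ?_
  rw [lintegral_add_right _ measurable_const]
  refine ENNReal.add_lt_top.2 ⟨hu1, ?_⟩
  rw [setLIntegral_const]
  exact ENNReal.mul_lt_top ENNReal.ofReal_lt_top hU

/-- Gradients of the form occurring for the cut-off functions are integrable. -/
lemma lintegral_leibniz_lt_top {U : Set X} (hUfin : μ U < ∞)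
    (hu1 : ∫⁻ x in U, (u x).abs ∂μ < ∞) (hg : Measurable g) (hg1 : ∫⁻ x in U, g x ∂μ < ∞)
    {c : ℝ} {h : X → ℝ≥0∞} (hh : ∀ᵐ x ∂μ.restrict U,
      h x ≤ g x + ENNReal.ofReal (max ((u x).toReal - k) 0) * ENNReal.ofReal c) :
    ∫⁻ x in U, h x ∂μ < ∞ := by
  refine (lintegral_mono_ae hh).trans_lt ?_
  rw [lintegral_add_left hg, lintegral_mul_const' _ _ ENNReal.ofReal_ne_top]
  exact ENNReal.add_lt_top.2 ⟨hg1, ENNReal.mul_lt_top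
    (lintegral_ofReal_max_sub_lt_top hUfin hu1 k) ENNReal.ofReal_lt_top⟩

variable [MetricSpace X] [BorelSpace X] {x₀ : X} {R s t : ℝ}

lemma IsWeakUpperGradient.mono_set {U V : Set X}
    (h : IsWeakUpperGradient μ U u g) (hVU : V ⊆ U) :
    IsWeakUpperGradient μ V u g := by
  refine isWeakUpperGradient_iff.2 ⟨h.1, ?_⟩
  filter_upwards [(isWeakUpperGradient_iff.1 h).2] with γ hγ hγV
  exact hγ fun t ht => hVU (hγV t ht)

lemma aemeasurable_cutTrunc {m : Measure X} (hu : AEMeasurable u m) :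
    AEMeasurable (cutTrunc u x₀ s t k) m :=
  continuous_cutoff.measurable.aemeasurable.mul
    ((hu.ereal_toReal.sub_const k).max aemeasurable_const)

/-- The competitor belongs to `N^{1,1}` and its minimal weak upper gradient obeys the Leibniz
rule. -/
lemma memNewtonian_competitor [ProperSpace X] {U : Set X} (hU : IsOpen U) (hUfin : μ U < ∞)
    (hu : AEMeasurable u (μ.restrict U)) (hu1 : ∫⁻ x in U, (u x).abs ∂μ < ∞)
    (hg : IsWeakUpperGradient μ U u g) (hg1 : ∫⁻ x in U, g x ∂μ < ∞) (hst : s < t) :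
    MemNewtonian μ U (fun x => (competitor u x₀ s t k x : EReal)) ∧
      ∀ᵐ x ∂μ.restrict U, minGrad μ U (fun x => (competitor u x₀ s t k x : EReal)) x ≤
        if k < (u x).toReal then ENNReal.ofReal (1 - cutoff x₀ s t x) * g x +
          ENNReal.ofReal ((u x).toReal - k) * ENNReal.ofReal (t - s)⁻¹ else g x := by
  have hu' := hu.ereal_toReal
  have hf := hu'.measurable_mk
  set f := hu'.mk with hfdef
  set G : X → ℝ≥0∞ := fun x => if k < f x then ENNReal.ofReal (1 - cutoff x₀ s t x) * g x +
    ENNReal.ofReal (f x - k) * ENNReal.ofReal (t - s)⁻¹ else g x with hG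
  have hGm : Measurable G := by
    refine Measurable.ite (measurableSet_lt measurable_const hf)
      (.add (.mul ?_ hg.1) (.mul_const ?_ _)) hg.1
    · exact ENNReal.measurable_ofReal.comp (continuous_cutoff.measurable.const_sub 1)
    · exact ENNReal.measurable_ofReal.comp (hf.sub_const k)
  have hGw : IsWeakUpperGradient μ U (fun x => (competitor u x₀ s t k x : EReal)) G := by
    refine isWeakUpperGradient_coe hGm ?_
    filter_upwards [hg.eventually_cutTrunc hU (.of_lintegral_lt_top hg1) hu'.ae_eq_mk hst]
      with γ hγ hγU
    exact (hγ hγU).2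
  have hG1 : ∫⁻ x in U, G x ∂μ < ∞ := by
    refine lintegral_leibniz_lt_top (k := k) (c := (t - s)⁻¹) hUfin hu1 hg.1 hg1 ?_
    filter_upwards [hu'.ae_eq_mk] with x hx
    rw [hx]
    simp only [hG]
    split_ifs
    · gcongr
      · refine mul_le_of_le_one_left zero_le ?_
        rw [← ENNReal.ofReal_one]
        exact ENNReal.ofReal_le_ofReal (sub_le_self _ cutoff_nonneg)
      · exact le_max_left _ _
    · exact le_self_add
  refine ⟨memNewtonian_of_isWeakUpperGradient ?_ ?_ hGw hG1, ?_⟩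
  · exact (hu'.sub (aemeasurable_cutTrunc hu)).coe_real_ereal
  · have hle : ∀ x, ((competitor u x₀ s t k x : ℝ) : EReal).abs ≤
        (u x).abs + ENNReal.ofReal (max ((u x).toReal - k) 0) := by
      intro x
      refine le_trans ?_ (add_le_add_left (ofReal_abs_toReal_le_abs _) _)
      rw [EReal.abs_def, ← ENNReal.ofReal_add (abs_nonneg _) (le_max_right _ _)]
      refine ENNReal.ofReal_le_ofReal ((abs_sub _ _).trans (add_le_add_right ?_ _))
      rw [abs_of_nonneg cutTrunc_nonneg]
      exact mul_le_of_le_one_left (le_max_right _ _) cutoff_le_one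
    refine (lintegral_mono hle).trans_lt ?_
    rw [lintegral_add_left' (f := fun x => (u x).abs) (measurable_ereal_abs.comp_aemeasurable hu)]
    exact ENNReal.add_lt_top.2 ⟨hu1, lintegral_ofReal_max_sub_lt_top hUfin hu1 k⟩
  · filter_upwards [minGrad_le hU hGw (.of_lintegral_lt_top hG1), hu'.ae_eq_mk] with x hx hxf
    rw [hxf]
    exact hx

/-- The function `η (u - k)_+` belongs to `N^{1,1}_0` of a ball containing the support of the
cut-off function in its interior. -/
lemma memNewtonianZero_sub_competitor [ProperSpace X] (hUfin : μ (Metric.ball x₀ R) < ∞)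
    (hu : AEMeasurable u (μ.restrict (Metric.ball x₀ R)))
    (hu1 : ∫⁻ x in Metric.ball x₀ R, (u x).abs ∂μ < ∞)
    (hg : IsWeakUpperGradient μ (Metric.ball x₀ R) u g)
    (hg1 : ∫⁻ x in Metric.ball x₀ R, g x ∂μ < ∞) (hst : s < t) (htR : t < R) :
    MemNewtonianZero μ (Metric.ball x₀ R) (fun x => u x - (competitor u x₀ s t k x : EReal)) := by
  have hU : IsOpen (Metric.ball x₀ R) := Metric.isOpen_ball
  set U := Metric.ball x₀ R with hUdef
  have hout : ∀ x ∉ U, cutTrunc u x₀ s t k x = 0 := fun x hx =>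
    cutTrunc_eq_zero hst (htR.le.trans (by simpa [hUdef] using hx))
  have hu' := hu.ereal_toReal
  have hf := hu'.measurable_mk
  set f := hu'.mk with hfdef
  set G : X → ℝ≥0∞ := fun x => if k < f x then ENNReal.ofReal (cutoff x₀ s t x) * g x +
    ENNReal.ofReal (f x - k) * ENNReal.ofReal (t - s)⁻¹ else 0 with hG
  have hGm : Measurable G := by
    refine Measurable.ite (measurableSet_lt measurable_const hf)
      (.add (.mul ?_ hg.1) (.mul_const ?_ _))
      measurable_const
    · exact ENNReal.measurable_ofReal.comp continuous_cutoff.measurable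
    · exact ENNReal.measurable_ofReal.comp (hf.sub_const k)
  have hGU : IsWeakUpperGradient μ U (fun x => (cutTrunc u x₀ s t k x : EReal)) G := by
    refine isWeakUpperGradient_coe hGm ?_
    filter_upwards [hg.eventually_cutTrunc hU (.of_lintegral_lt_top hg1) hu'.ae_eq_mk hst]
      with γ hγ hγU
    exact (hγ hγU).1
  have hG1 : ∫⁻ x in U, G x ∂μ < ∞ := by
    refine lintegral_leibniz_lt_top (k := k) (c := (t - s)⁻¹) hUfin hu1 hg.1 hg1 ?_
    filter_upwards [hu'.ae_eq_mk] with x hx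
    rw [hx]
    simp only [hG]
    split_ifs
    · gcongr
      · refine mul_le_of_le_one_left zero_le ?_
        rw [← ENNReal.ofReal_one]
        exact ENNReal.ofReal_le_ofReal cutoff_le_one
      · exact le_max_left _ _
    · exact zero_le
  have hGi : Measurable (U.indicator G) := hGm.indicator hU.measurableSet
  have hGw : IsWeakUpperGradient μ univ (fun x => (cutTrunc u x₀ s t k x : EReal))
      (U.indicator G) := by
    refine IsWeakUpperGradient.of_union_eq_univ (V₁ := U) (V₂ := {x | t < dist x x₀}) hU
      (isOpen_lt continuous_const (by fun_prop)) ?_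
      (hGU.congr_gradient hGi fun x hx => (indicator_of_mem hx G).symm) ?_
    · refine eq_univ_of_forall fun x => ?_
      rcases lt_or_ge t (dist x x₀) with h | h
      · exact Or.inr h
      · exact Or.inl (h.trans_lt htR)
    · refine IsUpperGradient.isWeakUpperGradient ⟨hGi, fun γ hγ => ?_⟩
      have h0 := cutTrunc_eq_zero (u := u) (k := k) hst (hγ 0 ⟨le_rfl, γ.len_pos.le⟩).le
      have h1 := cutTrunc_eq_zero (u := u) (k := k) hst (hγ γ.len ⟨γ.len_pos.le, le_rfl⟩).le
      refine ⟨fun a b ha hb => ?_, ?_⟩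
      · rw [EReal.coe_eq_coe_iff] at ha hb
        simp [← ha, ← hb, h0, h1]
      · rintro (h | h) <;> exact absurd ⟨_, rfl⟩ h
  refine ⟨fun x => (cutTrunc u x₀ s t k x : EReal),
    memNewtonian_of_isWeakUpperGradient ?_ ?_ hGw ?_, ?_, ?_⟩
  · rw [Measure.restrict_univ]
    refine AEMeasurable.coe_real_ereal ?_
    have : cutTrunc u x₀ s t k = U.indicator (cutTrunc u x₀ s t k) := by
      refine (indicator_eq_self.2 fun x hx => ?_).symm
      by_contra hxU
      exact hx (hout x hxU)
    rw [this]
    exact (aemeasurable_indicator_iff hU.measurableSet).2 (aemeasurable_cutTrunc hu)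
  · rw [Measure.restrict_univ]
    refine lt_of_le_of_lt (lintegral_mono fun x => ?_)
      (lt_of_eq_of_lt (lintegral_indicator hU.measurableSet _)
        (lintegral_ofReal_max_sub_lt_top hUfin hu1 k))
    rw [EReal.abs_def, abs_of_nonneg cutTrunc_nonneg]
    by_cases hx : x ∈ U
    · rw [indicator_of_mem hx]
      exact ENNReal.ofReal_le_ofReal (mul_le_of_le_one_left (le_max_right _ _) cutoff_le_one)
    · simp [hout x hx]
  · rwa [Measure.restrict_univ, lintegral_indicator hU.measurableSet]
  · filter_upwards [ae_eq_coe_toReal hu hu1] with x hx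
    conv_rhs => rw [hx]
    rw [← EReal.coe_sub, competitor, sub_sub_cancel]
  · filter_upwards [ae_restrict_mem hU.measurableSet.compl] with x hx
    rw [hout x hx, EReal.coe_zero]

end

section

/-! ### The iteration lemma -/

/-- Hole filling and iteration: if `φ s` is controlled by the increment `φ t - φ s` and by a term
of order `(t - s)^(-q)`, for all `ρ ≤ s < t < R`, then `φ ρ` is controlled by the latter with
`t - s = R - ρ`. The constant depends only on `M` and `q`. -/
lemma exists_const_forall_le_of_hole_filling {M q : ℝ} (hM : 0 < M) (hq : 0 < q) :
    ∃ C : ℝ, 0 < C ∧ ∀ (φ : ℝ → ℝ) (ρ R P B : ℝ), ρ < R → 0 ≤ P → (∀ r < R, φ r ≤ B) →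
      (∀ s t, ρ ≤ s → s < t → t < R →
        φ s ≤ M * (φ t - φ s + ((R - ρ) / (t - s)) ^ q * P)) → φ ρ ≤ C * P := by
  -- filling the hole gives the factor `θ < 1`; the radii `R - l ^ i * (R - ρ)` are chosen such
  -- that `θ / l ^ q` is still less than one
  set θ : ℝ := M / (1 + M) with hθ
  have hθ0 : 0 < θ := by positivity
  have hθ1 : θ < 1 := by rw [hθ, div_lt_one (by positivity)]; linarith
  set m : ℝ := (1 + θ) / 2 with hm
  have hm0 : 0 < m := by positivity
  have hm1 : m < 1 := by rw [hm]; linarith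
  set l : ℝ := m ^ q⁻¹ with hl
  have hl0 : 0 < l := Real.rpow_pos_of_pos hm0 _
  have hl1 : l < 1 := Real.rpow_lt_one hm0.le hm1 (inv_pos.2 hq)
  have hlq : l ^ q = m := Real.rpow_inv_rpow hm0.le hq.ne'
  set c : ℝ := θ / m with hc
  have hc0 : 0 < c := by positivity
  have hc1 : c < 1 := by rw [hc, div_lt_one hm0, hm]; linarith
  set d : ℝ := ((1 - l) ^ q)⁻¹ with hd
  have hd0 : 0 < d := inv_pos.2 (Real.rpow_pos_of_pos (sub_pos.2 hl1) _)
  have hc1' : 0 < 1 - c := sub_pos.2 hc1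
  refine ⟨θ * d * (1 - c)⁻¹, by positivity, fun φ ρ R P B hρR hP hB hφ => ?_⟩
  have hD : 0 < R - ρ := sub_pos.2 hρR
  have hfill : ∀ s t, ρ ≤ s → s < t → t < R →
      φ s ≤ θ * (φ t + ((R - ρ) / (t - s)) ^ q * P) := by
    intro s t hs hst ht
    have := hφ s t hs hst ht
    rw [hθ, div_mul_eq_mul_div, le_div_iff₀ (by positivity)]
    linarith
  set r : ℕ → ℝ := fun i => R - l ^ i * (R - ρ) with hr
  have hstep : ∀ i, φ (r i) ≤ θ * φ (r (i + 1)) + θ * ((m ^ i)⁻¹ * d) * P := by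
    intro i
    have hli : 0 < l ^ i := pow_pos hl0 i
    have hli1 : l ^ i ≤ 1 := pow_le_one₀ hl0.le hl1.le
    have hdiff : r (i + 1) - r i = l ^ i * (1 - l) * (R - ρ) := by simp only [hr, pow_succ]; ring
    have hpos : 0 < l ^ i * (1 - l) := mul_pos hli (sub_pos.2 hl1)
    have h := hfill (r i) (r (i + 1)) (by simp only [hr]; nlinarith)
      (by rw [← sub_pos, hdiff]; positivity)
      (by simp only [hr]; rw [sub_lt_self_iff]; positivity)
    have hquot : ((R - ρ) / (r (i + 1) - r i)) ^ q = (m ^ i)⁻¹ * d := by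
      rw [hdiff, show (R - ρ) / (l ^ i * (1 - l) * (R - ρ)) = (l ^ i * (1 - l))⁻¹ by
        field_simp, Real.inv_rpow hpos.le, Real.mul_rpow hli.le (sub_pos.2 hl1).le, mul_inv,
        ← Real.rpow_natCast l i, ← Real.rpow_mul hl0.le, mul_comm (i : ℝ) q,
        Real.rpow_mul hl0.le, hlq, Real.rpow_natCast]
    rw [hquot] at h
    linarith
  have hiter : ∀ n, φ ρ ≤ θ ^ n * φ (r n) + θ * d * P * ∑ i ∈ Finset.range n, c ^ i := by
    intro n
    induction n with
    | zero => simp [hr]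
    | succ n ih =>
      have h := mul_le_mul_of_nonneg_left (hstep n) (pow_pos hθ0 n).le
      have hcn : θ ^ n * (m ^ n)⁻¹ = c ^ n := by
        rw [hc, div_pow θ, div_eq_mul_inv]
      have e : θ ^ n * (θ * φ (r (n + 1)) + θ * ((m ^ n)⁻¹ * d) * P) =
          θ ^ (n + 1) * φ (r (n + 1)) + θ * d * P * c ^ n := by
        rw [← hcn]; ring
      rw [e] at h
      rw [Finset.sum_range_succ, mul_add]
      linarith
  have hbound : ∀ n, φ ρ ≤ θ ^ n * B + θ * d * P * (1 - c)⁻¹ := by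
    intro n
    have hsum : ∑ i ∈ Finset.range n, c ^ i ≤ (1 - c)⁻¹ := by
      rw [← tsum_geometric_of_lt_one hc0.le hc1]
      exact (summable_geometric_of_lt_one hc0.le hc1).sum_le_tsum _ fun i _ => (pow_pos hc0 i).le
    refine (hiter n).trans (add_le_add ?_ ?_)
    · refine mul_le_mul_of_nonneg_left (hB _ ?_) (pow_pos hθ0 n).le
      simp only [hr]
      rw [sub_lt_self_iff]
      positivity
    · exact mul_le_mul_of_nonneg_left hsum (by positivity)
  have hlim : Tendsto (fun n : ℕ => θ ^ n * B + θ * d * P * (1 - c)⁻¹) atTop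
      (𝓝 (0 * B + θ * d * P * (1 - c)⁻¹)) :=
    ((tendsto_pow_atTop_nhds_zero_of_lt_one hθ0.le hθ1).mul_const B).add_const _
  refine (ge_of_tendsto' hlim hbound).trans (le_of_eq ?_)
  ring

/-! ### The double phase density -/

section Density

variable {X : Type*} {a : X → ℝ≥0} {p q : ℝ} {x : X}

lemma H_mono (hp : 0 ≤ p) (hq : 0 ≤ q) {y z : ℝ≥0∞} (h : y ≤ z) : H a p q x y ≤ H a p q x z := by
  unfold H
  gcongr

lemma H_zero (hp : 0 < p) (hq : 0 < q) : H a p q x 0 = 0 := by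
  simp [H, hp, hq]

lemma H_add_le (hp : 1 ≤ p) (hpq : p ≤ q) (y z : ℝ≥0∞) :
    H a p q x (y + z) ≤ 2 ^ q * (H a p q x y + H a p q x z) := by
  have key : ∀ r : ℝ, 1 ≤ r → r ≤ q → (y + z) ^ r ≤ 2 ^ q * (y ^ r + z ^ r) := by
    intro r hr hrq
    refine (ENNReal.rpow_add_le_mul_rpow_add_rpow y z hr).trans ?_
    gcongr
    · exact one_le_two
    · linarith
  unfold H
  calc (y + z) ^ p + a x * (y + z) ^ q
      ≤ 2 ^ q * (y ^ p + z ^ p) + a x * (2 ^ q * (y ^ q + z ^ q)) := by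
        gcongr
        · exact key p hp hpq
        · exact key q (hp.trans hpq) le_rfl
    _ = _ := by ring

lemma H_mul_le (hp : 0 ≤ p) (hpq : p ≤ q) {c : ℝ≥0∞} (hc : 1 ≤ c) (z : ℝ≥0∞) :
    H a p q x (c * z) ≤ c ^ q * H a p q x z := by
  unfold H
  rw [ENNReal.mul_rpow_of_nonneg _ _ hp, ENNReal.mul_rpow_of_nonneg _ _ (hp.trans hpq), mul_add]
  have : c ^ p ≤ c ^ q := ENNReal.rpow_le_rpow_of_exponent_le hc hpq
  calc c ^ p * z ^ p + a x * (c ^ q * z ^ q) ≤ c ^ q * z ^ p + a x * (c ^ q * z ^ q) := by gcongr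
    _ = _ := by ring

lemma H_div_le (hp : 0 ≤ p) (hpq : p ≤ q) {δ D : ℝ} (hδ : 0 < δ) (hδD : δ ≤ D) (z : ℝ≥0∞) :
    H a p q x (z / ENNReal.ofReal δ) ≤
      ENNReal.ofReal ((D / δ) ^ q) * H a p q x (z / ENNReal.ofReal D) := by
  have hD : 0 < D := hδ.trans_le hδD
  have h1 : z / ENNReal.ofReal δ = ENNReal.ofReal (D / δ) * (z / ENNReal.ofReal D) := by
    rw [div_eq_mul_inv z, div_eq_mul_inv z, ← ENNReal.ofReal_inv_of_pos hδ,
      ← ENNReal.ofReal_inv_of_pos hD, mul_left_comm, ← ENNReal.ofReal_mul (by positivity)]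
    congr 2
    field_simp
  rw [h1, ← ENNReal.ofReal_rpow_of_nonneg (by positivity) (hp.trans hpq)]
  refine H_mul_le hp hpq ?_ _
  rw [← ENNReal.ofReal_one]
  exact ENNReal.ofReal_le_ofReal ((one_le_div hδ).2 hδD)

lemma aemeasurable_H [MeasurableSpace X] {m : Measure X} (ha : AEMeasurable a m)
    {f : X → ℝ≥0∞} (hf : AEMeasurable f m) : AEMeasurable (fun x => H a p q x (f x)) m :=
  (hf.pow_const p).add (ha.coe_nnreal_ennreal.mul (hf.pow_const q))

end Density

/-! ### The energy estimate -/

variable {X : Type*} [MeasurableSpace X] {μ : Measure X} {Ω : Set X} {u : X → EReal}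

lemma ae_toENNReal_truncPos {m : Measure X} (hu : AEMeasurable u m)
    (hu1 : ∫⁻ x, (u x).abs ∂m < ∞) (k : ℝ) :
    ∀ᵐ x ∂m, (truncPos u k x).toENNReal = ENNReal.ofReal (max ((u x).toReal - k) 0) := by
  filter_upwards [ae_eq_coe_toReal hu hu1] with x hx
  rw [truncPos_coe u k _ x hx, EReal.toENNReal_of_ne_top (EReal.coe_ne_top _), EReal.toReal_coe]

variable [MetricSpace X]

lemma MemNewtonianLoc.aemeasurable [ProperSpace X] (hΩ : IsOpen Ω) (hu : MemNewtonianLoc μ Ω u) :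
    AEMeasurable u (μ.restrict Ω) := by
  obtain ⟨V, hVo, hVc, hV⟩ := exists_open_exhaustion hΩ
  have hsub : Ω ⊆ ⋃ n, V n := by
    intro x hx
    obtain ⟨n, hn⟩ := hV {x} isCompact_singleton (singleton_subset_iff.2 hx)
    exact mem_iUnion.2 ⟨n, hn rfl⟩
  exact (aemeasurable_iUnion_iff.2 fun n => (hu (V n) (hVo n) (hVc n)).1).mono_measure
    (Measure.restrict_mono hsub le_rfl)

variable [BorelSpace X] {a : X → ℝ≥0} {p q K : ℝ} {x₀ : X} {R s t k : ℝ}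

/-- Testing quasiminimality with the competitor bounds the energy of `u` over `{u > k}` in a ball
by its energy in a surrounding annulus and the energy of the cut-off term. -/
lemma IsLocalQuasiminimizer.energy_le [ProperSpace X] (hΩ : IsOpen Ω)
    (ha : AEMeasurable a (μ.restrict Ω)) (hp : 1 < p) (hpq : p ≤ q)
    (hu : IsLocalQuasiminimizer μ Ω a p q K u) (hμ : μ (Metric.ball x₀ R) < ∞)
    (hc : CompactlyIn (Metric.ball x₀ R) Ω) (hst : s < t) (htR : t < R) :
    ∫⁻ x in Metric.ball x₀ s,
        {x | k < (u x).toReal}.indicator (fun x => H a p q x (minGrad μ Ω u x)) x ∂μ ≤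
      ENNReal.ofReal K * (2 ^ q * (∫⁻ x in Metric.ball x₀ t \ Metric.ball x₀ s,
        {x | k < (u x).toReal}.indicator (fun x => H a p q x (minGrad μ Ω u x)) x ∂μ +
        ∫⁻ x in Metric.ball x₀ R,
          H a p q x ((truncPos u k x).toENNReal / ENNReal.ofReal (t - s)) ∂μ)) := by
  have hp0 : 0 < p := zero_lt_one.trans hp
  have hq0 : 0 < q := hp0.trans_le hpq
  have hV : IsOpen (Metric.ball x₀ R) := Metric.isOpen_ball
  have hsV : Metric.ball x₀ s ⊆ Metric.ball x₀ R :=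
    Metric.ball_subset_ball (hst.trans htR).le
  have htV : Metric.ball x₀ t \ Metric.ball x₀ s ⊆ Metric.ball x₀ R :=
    sdiff_subset.trans (Metric.ball_subset_ball htR.le)
  set V := Metric.ball x₀ R with hVdef
  have hVΩ : V ⊆ Ω := subset_closure.trans hc.2
  obtain ⟨hum, hu1, -⟩ := hu.1.1 V hV hc
  have hmin := hu.1.1.isMinimalWeakUpperGradient hΩ
  set G := minGrad μ Ω u with hG
  have hGV : IsWeakUpperGradient μ V u G := hmin.1.mono_set hVΩ
  have hG1 : ∫⁻ x in V, G x ∂μ < ∞ := hmin.2.1 V hV hc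
  obtain ⟨hv, hgv⟩ := memNewtonian_competitor (x₀ := x₀) (k := k) hV hμ hum hu1 hGV hG1 hst
  have hv0 := memNewtonianZero_sub_competitor (k := k) hμ hum hu1 hGV hG1 hst htR
  have hquasi := hu.2 V hV hc _ hv hv0
  set v : X → EReal := fun x => (competitor u x₀ s t k x : EReal) with hvdef
  set N : Set X := {x | u x ≠ v x} with hN
  have hNm : NullMeasurableSet N (μ.restrict V) := (nullMeasurableSet_eq_fun hum hv.1).compl
  have hreal := ae_eq_coe_toReal hum hu1
  have hVN : (μ.restrict V).restrict N = μ.restrict (V ∩ N) := by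
    rw [Measure.restrict_restrict₀ hNm, inter_comm]
  set S : Set X := {x | k < (u x).toReal} with hS
  set F : X → ℝ≥0∞ := S.indicator fun x => H a p q x (G x) with hF
  set T : X → ℝ≥0∞ := fun x => H a p q x ((truncPos u k x).toENNReal / ENNReal.ofReal (t - s))
    with hT
  have htrunc := ae_toENNReal_truncPos hum hu1 k
  have hTm : AEMeasurable T (μ.restrict V) := by
    refine aemeasurable_H (ha.mono_measure (Measure.restrict_mono hVΩ le_rfl)) ?_
    refine AEMeasurable.div_const ?_ _
    refine AEMeasurable.congr ?_ (htrunc.mono fun x hx => hx.symm)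
    exact ((hum.ereal_toReal.sub_const k).max aemeasurable_const).ennreal_ofReal
  have hleft : ∫⁻ x in Metric.ball x₀ s, F x ∂μ ≤ ∫⁻ x in V ∩ N, H a p q x (G x) ∂μ := by
    calc ∫⁻ x in Metric.ball x₀ s, F x ∂μ
        = ∫⁻ x in V, (Metric.ball x₀ s).indicator F x ∂μ := by
          rw [lintegral_indicator measurableSet_ball, Measure.restrict_restrict measurableSet_ball,
            inter_eq_left.2 hsV]
      _ ≤ ∫⁻ x in V, N.indicator (fun x => H a p q x (G x)) x ∂μ := by
          refine lintegral_mono_ae ?_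
          filter_upwards [hreal] with x hx
          by_cases hxs : x ∈ Metric.ball x₀ s
          swap
          · simp [hxs]
          by_cases hxS : x ∈ S
          swap
          · simp [hxs, hF, hxS]
          -- on `{u > k}` the competitor equals `k` where the cut-off function is one
          have hxN : x ∈ N := by
            intro he
            rw [hx, hvdef, EReal.coe_eq_coe_iff, competitor, cutTrunc,
              cutoff_eq_one hst (Metric.mem_ball.1 hxs).le, one_mul,
              max_eq_left (sub_pos.2 hxS).le] at he
            have : k < (u x).toReal := hxS
            linarith
          simp [hxs, hF, hxS, hxN]
      _ ≤ ∫⁻ x in V ∩ N, H a p q x (G x) ∂μ := by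
          rw [← hVN]
          exact lintegral_indicator_le _ _
  have hright : ∫⁻ x in V ∩ N, H a p q x (minGrad μ V v x) ∂μ ≤
      2 ^ q * (∫⁻ x in Metric.ball x₀ t \ Metric.ball x₀ s, F x ∂μ + ∫⁻ x in V, T x ∂μ) := by
    calc ∫⁻ x in V ∩ N, H a p q x (minGrad μ V v x) ∂μ
        = ∫⁻ x in V, N.indicator (fun x => H a p q x (minGrad μ V v x)) x ∂μ := by
          rw [lintegral_indicator₀ hNm, hVN]
      _ ≤ ∫⁻ x in V, 2 ^ q * ((Metric.ball x₀ t \ Metric.ball x₀ s).indicator F x + T x) ∂μ := by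
          refine lintegral_mono_ae ?_
          filter_upwards [hreal, hgv, htrunc] with x hx hgx htx
          by_cases hxN : x ∈ N
          swap
          · simp [hxN]
          have hne : cutTrunc u x₀ s t k x ≠ 0 := by
            intro h0
            apply hxN
            rw [hvdef]
            simp only [competitor, h0, sub_zero]
            exact hx
          have hxS : k < (u x).toReal := by
            by_contra hk
            exact hne (by rw [cutTrunc, max_eq_right (by linarith), mul_zero])
          have hxt : x ∈ Metric.ball x₀ t := by
            by_contra hxt
            exact hne (cutTrunc_eq_zero hst (by simpa using hxt))
          rw [if_pos hxS] at hgx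
          rw [indicator_of_mem hxN]
          refine (H_mono hp0.le hq0.le hgx).trans ((H_add_le hp.le hpq _ _).trans ?_)
          refine mul_le_mul' le_rfl (add_le_add ?_ ?_)
          · by_cases hxs : x ∈ Metric.ball x₀ s
            · rw [cutoff_eq_one hst (Metric.mem_ball.1 hxs).le, sub_self, ENNReal.ofReal_zero,
                zero_mul, H_zero hp0 hq0]
              exact zero_le
            · rw [indicator_of_mem (show x ∈ _ \ _ from ⟨hxt, hxs⟩), hF,
                indicator_of_mem (show x ∈ S from hxS)]
              refine H_mono hp0.le hq0.le (mul_le_of_le_one_left zero_le ?_)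
              rw [← ENNReal.ofReal_one]
              exact ENNReal.ofReal_le_ofReal (sub_le_self _ cutoff_nonneg)
          · rw [hT]
            simp only [htx]
            rw [max_eq_left (sub_pos.2 hxS).le, ENNReal.ofReal_inv_of_pos (sub_pos.2 hst),
              div_eq_mul_inv]
      _ = 2 ^ q * (∫⁻ x in Metric.ball x₀ t \ Metric.ball x₀ s, F x ∂μ + ∫⁻ x in V, T x ∂μ) := by
          rw [lintegral_const_mul' _ _ (ENNReal.rpow_ne_top_of_nonneg hq0.le ENNReal.ofNat_ne_top),
            lintegral_add_right' _ hTm,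
            lintegral_indicator (measurableSet_ball.diff measurableSet_ball),
            Measure.restrict_restrict (measurableSet_ball.diff measurableSet_ball),
            inter_eq_left.2 htV]
  calc ∫⁻ x in Metric.ball x₀ s, F x ∂μ ≤ _ := hleft
    _ ≤ _ := hquasi
    _ ≤ _ := by gcongr

/-- The minimal weak upper gradient of `(u - k)_+` is at most that of `u` on `{u > k}`, and it
vanishes elsewhere. -/
lemma minGrad_truncPos_le [ProperSpace X] (hΩ : IsOpen Ω) (hu : MemNewtonianLoc μ Ω u) (k : ℝ) :
    ∀ᵐ x ∂μ.restrict Ω, minGrad μ Ω (truncPos u k) x ≤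
      if k < (u x).toReal then minGrad μ Ω u x else 0 := by
  have hmin := hu.isMinimalWeakUpperGradient hΩ
  obtain ⟨g', hg', hae⟩ := hmin.1.truncPos hΩ hmin.2.1 (hu.aemeasurable hΩ) k
  have hfin : LocallyFiniteIntegral μ Ω g' := by
    refine hmin.2.1.mono ?_
    filter_upwards [hae] with x hx
    rw [hx]
    split_ifs
    · exact le_rfl
    · exact zero_le
  filter_upwards [minGrad_le hΩ hg' hfin, hae] with x h1 h2
  exact h1.trans h2.le

/-- The Caccioppoli inequality for `(u - k)_+`, with the constant of the iteration lemma for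
`M = K * 2 ^ q`. -/
lemma IsLocalQuasiminimizer.caccioppoli_truncPos [ProperSpace X] {C : ℝ}
    (hC : ∀ (φ : ℝ → ℝ) (ρ R P B : ℝ), ρ < R → 0 ≤ P → (∀ r < R, φ r ≤ B) →
      (∀ s t, ρ ≤ s → s < t → t < R →
        φ s ≤ K * 2 ^ q * (φ t - φ s + ((R - ρ) / (t - s)) ^ q * P)) → φ ρ ≤ C * P)
    (hC0 : 0 < C) (hK : 0 ≤ K) (hΩ : IsOpen Ω) (ha : AEMeasurable a (μ.restrict Ω))
    (hp : 1 < p) (hpq : p ≤ q) (hμ : ∀ x r, μ (Metric.ball x r) < ∞)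
    (hu : IsLocalQuasiminimizer μ Ω a p q K u) :
    Caccioppoli μ Ω a p q C (truncPos u) := by
  intro x₀ ρ R k hρ hρR hc
  have hp0 : 0 < p := zero_lt_one.trans hp
  have hq0 : 0 < q := hp0.trans_le hpq
  have hVΩ : Metric.ball x₀ R ⊆ Ω := subset_closure.trans hc.2
  set F : X → ℝ≥0∞ :=
    {x | k < (u x).toReal}.indicator fun x => H a p q x (minGrad μ Ω u x) with hF
  set P : ℝ≥0∞ := ∫⁻ x in Metric.ball x₀ R,
    H a p q x ((truncPos u k x).toENNReal / ENNReal.ofReal (R - ρ)) ∂μ with hP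
  have hlhs : ∫⁻ x in Metric.ball x₀ ρ, H a p q x (minGrad μ Ω (truncPos u k) x) ∂μ ≤
      ∫⁻ x in Metric.ball x₀ ρ, F x ∂μ := by
    refine lintegral_mono_ae (ae_restrict_of_ae_restrict_of_subset
      ((Metric.ball_subset_ball hρR.le).trans hVΩ) ?_)
    filter_upwards [minGrad_truncPos_le hΩ hu.1.1 k] with x hx
    refine (H_mono hp0.le hq0.le hx).trans ?_
    by_cases hk : k < (u x).toReal
    · simp [hF, hk]
    · simp [hk, H_zero hp0 hq0]
  refine hlhs.trans ?_
  by_cases hPtop : P = ∞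
  · rw [hPtop, ENNReal.mul_top (by simpa using hC0)]
    exact le_top
  set A : ℝ → ℝ≥0∞ := fun r => ∫⁻ x in Metric.ball x₀ r, F x ∂μ with hA
  have hAR : A R < ∞ := by
    refine (lintegral_mono fun x => ?_).trans_lt (hu.1.2 _ Metric.isOpen_ball hc)
    exact indicator_le_self _ _ x
  have hAmono : Monotone A := fun r r' h => lintegral_mono_set (Metric.ball_subset_ball h)
  have hAfin : ∀ r ≤ R, A r ≠ ∞ := fun r hr => ((hAmono hr).trans_lt hAR).ne
  have hmain := hC (fun r => (A r).toReal) ρ R P.toReal (A R).toReal hρR ENNReal.toReal_nonneg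
    (fun r hr => ENNReal.toReal_mono hAR.ne (hAmono hr.le)) (by
      intro s t hs hst htR
      have hsplit : A t = A s + ∫⁻ x in Metric.ball x₀ t \ Metric.ball x₀ s, F x ∂μ := by
        have := lintegral_inter_add_sdiff (μ := μ) F (Metric.ball x₀ t)
          (measurableSet_ball (x := x₀) (ε := s))
        rw [inter_eq_right.2 (Metric.ball_subset_ball hst.le)] at this
        exact this.symm
      have hDfin : ∫⁻ x in Metric.ball x₀ t \ Metric.ball x₀ s, F x ∂μ ≠ ∞ :=
        ne_top_of_le_ne_top (hAfin t htR.le) (hsplit ▸ le_add_self)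
      have hδ : 0 < t - s := sub_pos.2 hst
      have hQ : ∫⁻ x in Metric.ball x₀ R,
          H a p q x ((truncPos u k x).toENNReal / ENNReal.ofReal (t - s)) ∂μ ≤
          ENNReal.ofReal (((R - ρ) / (t - s)) ^ q) * P := by
        rw [hP, ← lintegral_const_mul' _ _ ENNReal.ofReal_ne_top]
        exact lintegral_mono fun x => H_div_le hp0.le hpq hδ (by linarith) _
      have h := hu.energy_le (k := k) hΩ ha hp hpq (hμ x₀ R) hc hst htR
      have h2 : A s ≤ ENNReal.ofReal K * (2 ^ q *
          (∫⁻ x in Metric.ball x₀ t \ Metric.ball x₀ s, F x ∂μ +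
            ENNReal.ofReal (((R - ρ) / (t - s)) ^ q) * P)) := h.trans (by gcongr)
      have h2q : (2 : ℝ≥0∞) ^ q ≠ ∞ := ENNReal.rpow_ne_top_of_nonneg hq0.le ENNReal.ofNat_ne_top
      have hPfin : ENNReal.ofReal (((R - ρ) / (t - s)) ^ q) * P ≠ ∞ :=
        ENNReal.mul_ne_top ENNReal.ofReal_ne_top hPtop
      have h3 := ENNReal.toReal_mono (ENNReal.mul_ne_top ENNReal.ofReal_ne_top
        (ENNReal.mul_ne_top h2q (ENNReal.add_ne_top.2 ⟨hDfin, hPfin⟩))) h2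
      have hquot : 0 ≤ ((R - ρ) / (t - s)) ^ q :=
        Real.rpow_nonneg (div_nonneg (sub_pos.2 hρR).le hδ.le) _
      rw [ENNReal.toReal_mul, ENNReal.toReal_ofReal hK, ENNReal.toReal_mul, ← ENNReal.toReal_rpow,
        ENNReal.toReal_ofNat, ENNReal.toReal_add hDfin hPfin, ENNReal.toReal_mul,
        ENNReal.toReal_ofReal hquot] at h3
      have hdiff : (A t).toReal - (A s).toReal =
          (∫⁻ x in Metric.ball x₀ t \ Metric.ball x₀ s, F x ∂μ).toReal := by
        rw [hsplit, ENNReal.toReal_add (hAfin s (hst.trans htR).le) hDfin, add_sub_cancel_left]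
      rw [hdiff, mul_assoc]
      exact h3)
  rw [← ENNReal.ofReal_toReal hPtop, ← ENNReal.ofReal_mul hC0.le,
    show ∫⁻ x in Metric.ball x₀ ρ, F x ∂μ = A ρ from rfl,
    ← ENNReal.ofReal_toReal (hAfin ρ hρR.le)]
  exact ENNReal.ofReal_le_ofReal hmain

/-! ### Change of sign -/

lemma UpperGradientIneq.neg {X : Type*} [MetricSpace X] {u : X → EReal} {g : X → ℝ≥0∞}
    {γ : Curve X} (h : UpperGradientIneq u g γ) : UpperGradientIneq (fun x => -u x) g γ := by
  have key : ∀ (z : EReal) (r : ℝ), -z = r ↔ z = (-r : ℝ) := fun z r => by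
    rw [neg_eq_iff_eq_neg, EReal.coe_neg]
  refine ⟨fun s t hs ht => ?_, fun hne => h.2 ?_⟩
  · have := h.1 (-s) (-t) ((key _ _).1 hs) ((key _ _).1 ht)
    rwa [neg_sub_neg, abs_sub_comm] at this
  · refine hne.imp (fun hn hs => hn ?_) fun hn hs => hn ?_ <;>
    · obtain ⟨r, hr⟩ := hs
      exact ⟨-r, (key _ _).2 (by rw [hr, neg_neg])⟩

lemma upperGradientIneq_neg_iff {X : Type*} [MetricSpace X] {u : X → EReal} {g : X → ℝ≥0∞}
    {γ : Curve X} : UpperGradientIneq (fun x => -u x) g γ ↔ UpperGradientIneq u g γ :=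
  ⟨fun h => by simpa only [neg_neg] using h.neg, fun h => h.neg⟩

lemma minGrad_neg {X : Type*} [MetricSpace X] [MeasurableSpace X] (μ : Measure X) (U : Set X)
    (u : X → EReal) : minGrad μ U (fun x => -u x) = minGrad μ U u := by
  have h : IsMinimalWeakUpperGradient μ U (fun x => -u x) = IsMinimalWeakUpperGradient μ U u := by
    funext g
    simp only [IsMinimalWeakUpperGradient, IsWeakUpperGradient, upperGradientIneq_neg_iff]
  unfold minGrad
  rw [h]

lemma MemNewtonian.neg {X : Type*} [MetricSpace X] [MeasurableSpace X] {μ : Measure X} {U : Set X}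
    {u : X → EReal} (h : MemNewtonian μ U u) : MemNewtonian μ U (fun x => -u x) := by
  obtain ⟨h1, h2, g, hg, hfin⟩ := h
  refine ⟨continuous_neg.measurable.comp_aemeasurable h1, by simpa only [EReal.abs_neg] using h2,
    g, ⟨hg.1, fun γ hγ => (hg.2 γ hγ).neg⟩, hfin⟩

/-- The negative of a local quasiminimizer is a local quasiminimizer, with the same constant. -/
lemma IsLocalQuasiminimizer.neg {X : Type*} [MetricSpace X] [MeasurableSpace X] {μ : Measure X}
    {Ω : Set X} {u : X → EReal} {a : X → ℝ≥0} {p q K : ℝ}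
    (hu : IsLocalQuasiminimizer μ Ω a p q K u) :
    IsLocalQuasiminimizer μ Ω a p q K (fun x => -u x) := by
  refine ⟨⟨fun V hV hc => (hu.1.1 V hV hc).neg, by simpa only [minGrad_neg] using hu.1.2⟩, ?_⟩
  intro V hV hc v hv ⟨w, hw, hwV, hw0⟩
  have hset : {x | -u x ≠ v x} = {x | u x ≠ -v x} := by
    ext x
    exact not_congr neg_eq_iff_eq_neg
  have h := hu.2 V hV hc (fun x => -v x) hv.neg ⟨fun x => -w x, hw.neg, ?_, ?_⟩
  · simpa only [minGrad_neg, hset] using h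
  · have hm := hu.1.1 V hV hc
    filter_upwards [hwV, ae_eq_coe_toReal hm.1 hm.2.1, ae_eq_coe_toReal hv.1 hv.2.1]
      with x h1 h2 h3
    rw [h1, h2, h3]
    norm_cast
    ring
  · filter_upwards [hw0] with x hx
    rw [hx, neg_zero]

lemma truncNeg_eq_truncPos_neg {X : Type*} (u : X → EReal) (k : ℝ) :
    truncNeg u k = truncPos (fun x => -u x) (-k) := by
  funext x
  rw [truncNeg, truncPos, EReal.neg_sub (Or.inr (EReal.coe_ne_bot k)) (Or.inr (EReal.coe_ne_top k)),
    sub_eq_add_neg, EReal.coe_neg, neg_neg]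

end

end DoublePhase

end

theorem mainTheorem9 (K q : ℝ) (hK : 1 ≤ K) (hq : 1 < q) :
    ∃ C : ℝ, 0 < C ∧
      ∀ (X : Type*) [MetricSpace X] [CompleteSpace X] [MeasurableSpace X] [BorelSpace X]
        (μ : Measure X), DoublePhase.IsDoubling μ →
      ∀ (Ω : Set X), IsOpen Ω →
      ∀ (a : X → ℝ≥0), AEMeasurable a (μ.restrict Ω) →
      ∀ (p : ℝ), 1 < p → p ≤ q →
      ∀ (u : X → EReal), DoublePhase.IsLocalQuasiminimizer μ Ω a p q K u →
        DoublePhase.Caccioppoli μ Ω a p q C (DoublePhase.truncPos u) ∧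
        DoublePhase.Caccioppoli μ Ω a p q C (DoublePhase.truncNeg u) ∧
        DoublePhase.MemDG μ Ω a p q u := by
  have hM : 0 < K * 2 ^ q := by positivity
  obtain ⟨C, hC0, hC⟩ :=
    DoublePhase.exists_const_forall_le_of_hole_filling hM (zero_lt_one.trans hq)
  refine ⟨C, hC0, ?_⟩
  intro X _ _ _ _ μ hμ Ω hΩ a ha p hp hpq u hu
  have : ProperSpace X := hμ.properSpace
  have hpos := hu.caccioppoli_truncPos hC hC0 (zero_le_one.trans hK) hΩ ha hp hpq
    hμ.measure_ball_lt_top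
  have hneg : DoublePhase.Caccioppoli μ Ω a p q C (DoublePhase.truncNeg u) := by
    intro x₀ ρ R k hρ hρR hc
    rw [DoublePhase.truncNeg_eq_truncPos_neg]
    exact hu.neg.caccioppoli_truncPos hC hC0 (zero_le_one.trans hK) hΩ ha hp hpq
      hμ.measure_ball_lt_top x₀ ρ R (-k) hρ hρR hc
  exact ⟨hpos, hneg, ⟨hu.1, C, hC0, hpos⟩, ⟨hu.1, C, hC0, hneg⟩⟩
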